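/- Let $\lambda>-1/2$, and for $n\ge 0$ let $\hat p^{(\lambda)}_n$ be the orthonormal ultraspherical polynomial, i.e. the polynomial of degree $n$ with positive leading coefficient such that $$\int_{-1}^1 \hat p^{(\lambda)}_m(t)\,\hat p^{(\lambda)}_n(t)\,(1-t^2)^{\lambda-1/2}\,dt=\delta_{m,n}.$$ For $i,j\ge 0$ put $$f^{(\lambda)}_{i,j}=\int_0^1 \hat p^{(\lambda)}_i(t)\,\hat p^{(\lambda)}_j(2t-1)\,(t(1-t))^{\lambda-1/2}\,dt .$$ Theorem. For fixed $\lambda>-1/2$ and fixed $j\ge 0$, as $i\to\infty$, $$f^{(\lambda)}_{i,j}=k_j\,\frac{\cos\left(\pi\left(j+\frac{\lambda}{2}-\frac{i}{2}+\frac14\right)\right)}{\sqrt{\pi}\,i^{\lambda+1/2}}+O\left(\frac{1}{i^{\lambda+3/2}}\right),$$ where the implied constant may depend on $\lambda$ and $j$, and $$k_j=\frac{1}{2^{2j+\lambda}}\sqrt{\frac{(2\lambda)_j}{j!\,(\lambda)_j\,(\lambda+1)_j\,\lambda\,\Gamma(2\lambda)}}\;\frac{\Gamma(2j+2\lambda+1)}{(\lambda+\frac12)_j}.$$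 Here $(a)_n=a(a+1)\cdots(a+n-1)$, and for $\lambda=0$ the expression for $k_j$ is replaced by its limit as $\lambda\to0$, namely $k_0=\sqrt2$ and $k_j=2$ for $j\ge1$. -/

import Mathlib

open Polynomial Filter Asymptotics

noncomputable section

/-- The inner product `∫_{-1}^{1} p(t) q(t) (1 - t²)^(λ - 1/2) dt` on real polynomials. -/
def ultraInner (lam : ℝ) (p q : ℝ[X]) : ℝ :=
  ∫ t in (-1 : ℝ)..1, p.eval t * q.eval t * (1 - t ^ 2) ^ (lam - 1 / 2)

/-- The monic ultraspherical polynomial of degree `n`: the monic polynomials orthogonal with respect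
to `(1 - t²)^(λ - 1/2) dt` on `[-1, 1]`, obtained from `1, t, t², …` by Gram–Schmidt. -/
def ultraMonic (lam : ℝ) (n : ℕ) : ℝ[X] :=
  X ^ n - ∑ k : Fin n,
    C (ultraInner lam (X ^ n) (ultraMonic lam k) /
      ultraInner lam (ultraMonic lam k) (ultraMonic lam k)) * ultraMonic lam k
termination_by n
decreasing_by exact k.isLt

/-- The orthonormal ultraspherical polynomial of degree `n`, with positive leading coefficient. -/
def ultraOrthonormal (lam : ℝ) (n : ℕ) : ℝ[X] :=
  C (1 / Real.sqrt (ultraInner lam (ultraMonic lam n) (ultraMonic lam n))) * ultraMonic lam n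

/-- The coefficient `f^{(λ)}_{i,j} = ∫_0^1 p̂_i(t) p̂_j(2t - 1) (t (1 - t))^(λ - 1/2) dt`. -/
def ultraCoeff (lam : ℝ) (i j : ℕ) : ℝ :=
  ∫ t in (0 : ℝ)..1, (ultraOrthonormal lam i).eval t * (ultraOrthonormal lam j).eval (2 * t - 1) *
    (t * (1 - t)) ^ (lam - 1 / 2)

/-- The Pochhammer symbol `(a)_n = a (a + 1) ⋯ (a + n - 1)`. -/
def poch (a : ℝ) (n : ℕ) : ℝ := (ascPochhammer ℝ n).eval a

/-- The amplitude `k_j`. For `λ = 0`, where the general expression has removable singularities,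
its value is the limit of that expression as `λ → 0`. -/
def ultraAmplitude (lam : ℝ) (j : ℕ) : ℝ :=
  if lam = 0 then (if j = 0 then Real.sqrt 2 else 2)
  else
    1 / (2 : ℝ) ^ (2 * (j : ℝ) + lam) *
      Real.sqrt (poch (2 * lam) j /
        ((j.factorial : ℝ) * poch lam j * poch (lam + 1) j * lam * Real.Gamma (2 * lam))) *
      (Real.Gamma (2 * (j : ℝ) + 2 * lam + 1) / poch (lam + 1 / 2) j)

end

/-! Write `R_n` for `gegen lam n`. Since `1 - t² = (1 - t)(1 + t)`, the coefficient is the integral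
over `[0, 1]` of `t ^ (λ - 1/2) r(t)` times the orthonormal polynomial of degree `i`, against the
ultraspherical weight. Here `r` is analytic on `[0, 1]`: it is the polynomial of degree `j` in `2t -
1` times `(1 + t) ^ (1/2 - λ)`. The only singularity not absorbed by the weight is at `t = 0`, and
`r 0` fixes the leading term (`ultraFunctional_asymptotics`).

For a pure power `t ^ s` the integral is an explicit product of Gamma values (`gegenMoment_eq`).
Reflection makes its oscillation explicit, and Gamma-ratio asymptotics give size `n ^ (-s - 1)`
after normalisation (`gegenMoment_isBigO`). For general `r`, split off `r 0` and write the rest as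
`t ^ (s + 1)` times an analytic divided difference (`ultraFunctional_decomp`). Repeating this raises
the exponent. Once it is large, self-adjointness of the ultraspherical operator trades two powers of
`t` for a factor `n ^ (-2)` (`ultraFunctional_step`), starting from a Cauchy–Schwarz type bound.

It remains to identify `R_n`, suitably scaled, with the Gram–Schmidt polynomials
(`ultraOrthonormal_eq`) and to match constants with `k_j` by the duplication formula
(`momentAmplitude_mul`). Normalising by the value at `1` keeps `λ = 0` from being exceptional. -/

/-- The ultraspherical polynomials normalised by the value `1` at `1`. -/
noncomputable def gegen (lam : ℝ) : ℕ → ℝ[X]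
  | 0 => 1
  | 1 => X
  | n + 2 => C (1 / ((n : ℝ) + 1 + 2 * lam)) *
      (C (2 * ((n : ℝ) + 1 + lam)) * X * gegen lam (n + 1) - C ((n : ℝ) + 1) * gegen lam n)

/-! ### Recurrence, structure relations and differential equation -/

section Algebra

variable {lam : ℝ}

lemma gegen_denom_pos (hlam : -(1 / 2) < lam) (n : ℕ) : 0 < (n : ℝ) + 1 + 2 * lam := by
  have : (0 : ℝ) ≤ n := n.cast_nonneg
  linarith

lemma gegen_rec (hlam : -(1 / 2) < lam) (n : ℕ) :
    C ((n : ℝ) + 1 + 2 * lam) * gegen lam (n + 2) =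
      C (2 * ((n : ℝ) + 1 + lam)) * X * gegen lam (n + 1) - C ((n : ℝ) + 1) * gegen lam n := by
  rw [gegen, ← mul_assoc, ← C_mul, mul_one_div_cancel (gegen_denom_pos hlam n).ne', C_1, one_mul]

/-- The two relations are proved together: the first at `n + 1` is the second at `n` rewritten by
the recurrence, while the second at `n + 1` comes from the differentiated recurrence and needs both
relations at `n`. -/
lemma gegen_derivative_aux (hlam : -(1 / 2) < lam) (n : ℕ) :
    (1 - X ^ 2) * derivative (gegen lam n) =
        C ((n : ℝ) + 2 * lam) * (X * gegen lam n - gegen lam (n + 1)) ∧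
      (1 - X ^ 2) * derivative (gegen lam (n + 1)) =
        C ((n : ℝ) + 1) * (gegen lam n - X * gegen lam (n + 1)) := by
  induction n with
  | zero => simp [gegen]; ring
  | succ n ih =>
    obtain ⟨h1, h2⟩ := ih
    have hr := gegen_rec hlam n
    have hd := congrArg derivative hr
    have hne : C ((n : ℝ) + 1 + 2 * lam) ≠ 0 := C_ne_zero.2 (gegen_denom_pos hlam n).ne'
    simp only [derivative_mul, derivative_sub, derivative_C, derivative_X, zero_mul, zero_add,
      mul_one] at hd
    simp only [map_add, map_mul, map_one, map_ofNat, Nat.cast_add, Nat.cast_one] at *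
    constructor
    · linear_combination h2 + hr
    · refine mul_left_cancel₀ hne ?_
      linear_combination (1 - X ^ 2) * hd + 2 * (C (n : ℝ) + 1 + C lam) * X * h2 -
        (C (n : ℝ) + 1) * h1 + (C (n : ℝ) + 1 + 1) * X * hr

/-- The ultraspherical differential equation. -/
lemma gegen_ode (hlam : -(1 / 2) < lam) (n : ℕ) :
    (1 - X ^ 2) * derivative (derivative (gegen lam n)) -
      C (2 * lam + 1) * X * derivative (gegen lam n) +
      C ((n : ℝ) * (n + 2 * lam)) * gegen lam n = 0 := by
  rcases n with _ | n
  · simp [gegen]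
  obtain ⟨h1, h2⟩ := gegen_derivative_aux hlam n
  have hd := congrArg derivative h2
  have hne : (1 - X ^ 2 : ℝ[X]) ≠ 0 := by
    intro h
    simpa using congrArg (eval 0) h
  simp only [derivative_mul, derivative_sub, derivative_C, derivative_X, derivative_one,
    derivative_X_pow, zero_mul, zero_add, zero_sub] at hd
  -- The differentiated relation still contains `R_n'`; the extra factor `1 - X ^ 2` lets the first
  -- structure relation eliminate it.
  refine mul_left_cancel₀ hne ?_
  norm_num at hd
  simp only [map_add, map_mul, map_one, map_ofNat, map_natCast, Nat.cast_add, Nat.cast_one] at *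
  linear_combination (1 - X ^ 2) * hd + ((n : ℝ[X]) + 1) * h1 - ((n : ℝ[X]) + 2 * C lam) * X * h2

lemma gegen_degree (hlam : -(1 / 2) < lam) (n : ℕ) :
    (gegen lam n).natDegree ≤ n ∧ 0 < (gegen lam n).coeff n := by
  induction n using Nat.twoStepInduction with
  | zero => simp [gegen]
  | one => simp [gegen]
  | more n ih1 ih2 =>
    have hp := gegen_denom_pos hlam n
    have hn : (0 : ℝ) ≤ n := n.cast_nonneg
    constructor
    · rw [gegen]
      refine (natDegree_C_mul_le _ _).trans ((natDegree_sub_le _ _).trans (max_le ?_ ?_))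
      · rw [mul_assoc]
        refine (natDegree_C_mul_le _ _).trans (natDegree_mul_le.trans ?_)
        have := ih2.1
        rw [natDegree_X]
        omega
      · exact (natDegree_C_mul_le _ _).trans (ih1.1.trans (by omega))
    · rw [gegen, coeff_C_mul, coeff_sub, mul_assoc, coeff_C_mul, coeff_X_mul, coeff_C_mul,
        coeff_eq_zero_of_natDegree_lt (lt_of_le_of_lt ih1.1 (by omega)), mul_zero, sub_zero]
      have := ih2.2
      have : 0 < (n : ℝ) + 1 + lam := by linarith
      positivity

/-- This is the source of the sign `(-1) ^ j`: the argument `2t - 1` equals `-1` at the singular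
endpoint `t = 0`. -/
lemma gegen_eval_neg_one (hlam : -(1 / 2) < lam) (n : ℕ) : (gegen lam n).eval (-1) = (-1) ^ n := by
  induction n using Nat.twoStepInduction with
  | zero => simp [gegen]
  | one => simp [gegen]
  | more n ih1 ih2 =>
    have hp := gegen_denom_pos hlam n
    simp only [gegen, eval_mul, eval_sub, eval_C, eval_X, ih1, ih2]
    field_simp
    ring

end Algebra

/-! ### Integrability of the weights and Green's identity -/

section Integrability

open MeasureTheory Set intervalIntegral

/-- Cutting at the midpoint leaves only one possibly singular factor on each half. -/
lemma intervalIntegrable_beta {p q s a : ℝ} (hpq : p < q) (hs : -1 < s) (ha : -1 < a) :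
    IntervalIntegrable (fun t : ℝ => (t - p) ^ s * (q - t) ^ a) volume p q := by
  have h1 : IntervalIntegrable (fun t : ℝ => (t - p) ^ s * (q - t) ^ a) volume p ((p + q) / 2) := by
    refine IntervalIntegrable.mul_continuousOn ?_ ?_
    · have h := (intervalIntegrable_rpow' hs (a := 0) (b := (q - p) / 2)).comp_sub_right p
      convert h using 1 <;> ring
    · rw [uIcc_of_le (by linarith)]
      refine ContinuousOn.rpow_const (by fun_prop) fun t ht => Or.inl ?_
      have := ht.2
      linarith
  have h2 : IntervalIntegrable (fun t : ℝ => (t - p) ^ s * (q - t) ^ a) volume ((p + q) / 2) q := by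
    refine IntervalIntegrable.continuousOn_mul ?_ ?_
    · have h := (intervalIntegrable_rpow' ha (a := (q - p) / 2) (b := 0)).comp_sub_left q
      convert h using 1 <;> ring
    · rw [uIcc_of_le (by linarith)]
      refine ContinuousOn.rpow_const (by fun_prop) fun t ht => Or.inl ?_
      have := ht.1
      linarith
  exact h1.trans h2

lemma intervalIntegrable_zero_one {lam s : ℝ} (hlam : -(1 / 2) < lam) (hs : -1 < s) {g : ℝ → ℝ}
    (hg : ContinuousOn g (Icc 0 1)) :
    IntervalIntegrable (fun t : ℝ => t ^ s * g t * (1 - t ^ 2) ^ (lam - 1 / 2)) volume 0 1 := by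
  have h := (intervalIntegrable_beta (p := 0) (q := 1) (a := lam - 1 / 2) one_pos hs
    (by linarith)).mul_continuousOn (g := fun t => g t * (1 + t) ^ (lam - 1 / 2)) (by
      rw [uIcc_of_le zero_le_one]
      refine hg.mul (ContinuousOn.rpow_const (by fun_prop) fun t ht => Or.inl ?_)
      have := ht.1
      linarith)
  refine h.congr fun t ht => ?_
  rw [uIoc_of_le zero_le_one] at ht
  have e : (1 - t ^ 2) = (1 - t) * (1 + t) := by ring
  simp only [sub_zero]
  rw [e, Real.mul_rpow (by linarith [ht.2]) (by linarith [ht.1])]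
  ring

lemma intervalIntegrable_weight {lam : ℝ} (hlam : -(1 / 2) < lam) {g : ℝ → ℝ}
    (hg : ContinuousOn g (Icc (-1) 1)) :
    IntervalIntegrable (fun t : ℝ => g t * (1 - t ^ 2) ^ (lam - 1 / 2)) volume (-1) 1 := by
  have h := (intervalIntegrable_beta (p := -1) (q := 1) (s := lam - 1 / 2) (a := lam - 1 / 2)
    (by norm_num) (by linarith) (by linarith)).continuousOn_mul (g := g) (by
      rwa [uIcc_of_le (by norm_num)])
  refine h.congr fun t ht => ?_
  rw [uIoc_of_le (by norm_num)] at ht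
  have e : (1 - t ^ 2) = (t - -1) * (1 - t) := by ring
  rw [e, Real.mul_rpow (by linarith [ht.1]) (by linarith [ht.2])]

/-- Green's identity for the ultraspherical differential operator on `[c, 1]`. -/
lemma integral_ultraspherical_green {lam c : ℝ} (hlam : -(1 / 2) < lam) (hc : -1 ≤ c) (hc1 : c ≤ 1)
    {g g1 g2 h h1 h2 : ℝ → ℝ} (cg : ContinuousOn g (Icc c 1)) (cg1 : ContinuousOn g1 (Icc c 1))
    (ch : ContinuousOn h (Icc c 1)) (ch1 : ContinuousOn h1 (Icc c 1))
    (dg : ∀ t ∈ Ioo c 1, HasDerivAt g (g1 t) t) (dg1 : ∀ t ∈ Ioo c 1, HasDerivAt g1 (g2 t) t)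
    (dh : ∀ t ∈ Ioo c 1, HasDerivAt h (h1 t) t) (dh1 : ∀ t ∈ Ioo c 1, HasDerivAt h1 (h2 t) t)
    (hbd : (1 - c ^ 2) ^ (lam + 1 / 2) * (g1 c * h c - g c * h1 c) = 0)
    (ig : IntervalIntegrable (fun t => h t * ((1 - t ^ 2) * g2 t - (2 * lam + 1) * t * g1 t) *
      (1 - t ^ 2) ^ (lam - 1 / 2)) volume c 1)
    (ih : IntervalIntegrable (fun t => g t * ((1 - t ^ 2) * h2 t - (2 * lam + 1) * t * h1 t) *
      (1 - t ^ 2) ^ (lam - 1 / 2)) volume c 1) :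
    ∫ t in c..1, h t * ((1 - t ^ 2) * g2 t - (2 * lam + 1) * t * g1 t) *
      (1 - t ^ 2) ^ (lam - 1 / 2) =
    ∫ t in c..1, g t * ((1 - t ^ 2) * h2 t - (2 * lam + 1) * t * h1 t) *
      (1 - t ^ 2) ^ (lam - 1 / 2) := by
  -- In self-adjoint form the operator is `w⁻¹ (w (1 - t²) g')'` with `w = (1 - t²) ^ (λ - 1/2)`, so
  -- the difference of the integrands is the derivative of a weighted Wronskian. It vanishes at `1`
  -- because `λ + 1/2 > 0`, and at `c` by `hbd`.
  rw [← sub_eq_zero, ← integral_sub ig ih,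
    integral_eq_sub_of_hasDerivAt_of_le hc1
      (f := fun t => (1 - t ^ 2) ^ (lam + 1 / 2) * (g1 t * h t - g t * h1 t)) ?_ ?_ (ig.sub ih)]
  · rw [hbd]
    norm_num
    left
    exact Real.zero_rpow (by linarith)
  · refine ContinuousOn.mul (ContinuousOn.rpow_const (by fun_prop) fun t _ => Or.inr (by linarith))
      ((cg1.mul ch).sub (cg.mul ch1))
  · intro t ht
    have hpos : 0 < 1 - t ^ 2 := by nlinarith [ht.1, ht.2]
    have hw : HasDerivAt (fun t : ℝ => (1 - t ^ 2) ^ (lam + 1 / 2))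
        (-(2 * t) * (lam + 1 / 2) * (1 - t ^ 2) ^ (lam + 1 / 2 - 1)) t := by
      refine HasDerivAt.rpow_const ?_ (Or.inl hpos.ne')
      simpa using ((hasDerivAt_pow 2 t).const_sub 1)
    have hprod := hw.mul (((dg1 t ht).mul (dh t ht)).sub ((dg t ht).mul (dh1 t ht)))
    refine hprod.congr_deriv ?_
    have e1 : lam + 1 / 2 - 1 = lam - 1 / 2 := by ring
    have e2 : (1 - t ^ 2) ^ (lam + 1 / 2) = (1 - t ^ 2) ^ (lam - 1 / 2) * (1 - t ^ 2) := by
      rw [← Real.rpow_add_one hpos.ne']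
      congr 1
      ring
    simp only [Pi.mul_apply, Pi.sub_apply]
    rw [e1, e2]
    ring

end Integrability

/-! ### Orthogonality and identification with Gram–Schmidt -/

section Orthogonality

open intervalIntegral

variable {lam : ℝ}

lemma ultraInner_integrable (hlam : -(1 / 2) < lam) (p q : ℝ[X]) :
    IntervalIntegrable (fun t : ℝ => p.eval t * q.eval t * (1 - t ^ 2) ^ (lam - 1 / 2))
      MeasureTheory.volume (-1) 1 :=
  intervalIntegrable_weight hlam (p.continuous.mul q.continuous).continuousOn

lemma ultraInner_comm (p q : ℝ[X]) : ultraInner lam p q = ultraInner lam q p := by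
  simp only [ultraInner, mul_comm (p.eval _)]

lemma ultraInner_add_left (hlam : -(1 / 2) < lam) (p q r : ℝ[X]) :
    ultraInner lam (p + q) r = ultraInner lam p r + ultraInner lam q r := by
  rw [ultraInner, ultraInner, ultraInner,
    ← integral_add (ultraInner_integrable hlam p r) (ultraInner_integrable hlam q r)]
  simp only [eval_add, add_mul]

lemma ultraInner_C_mul_left (c : ℝ) (p r : ℝ[X]) :
    ultraInner lam (C c * p) r = c * ultraInner lam p r := by
  rw [ultraInner, ultraInner, ← integral_const_mul]
  simp only [eval_mul, eval_C, mul_assoc]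

lemma ultraInner_C_mul_right (c : ℝ) (p r : ℝ[X]) :
    ultraInner lam p (C c * r) = c * ultraInner lam p r := by
  rw [ultraInner_comm, ultraInner_C_mul_left, ultraInner_comm]

lemma ultraInner_sub_left (hlam : -(1 / 2) < lam) (p q r : ℝ[X]) :
    ultraInner lam (p - q) r = ultraInner lam p r - ultraInner lam q r := by
  have h := ultraInner_add_left hlam p (C (-1) * q) r
  rw [ultraInner_C_mul_left] at h
  rw [sub_eq_add_neg, sub_eq_add_neg, ← neg_one_mul (ultraInner lam q r), ← h]
  simp

lemma ultraInner_sum_left (hlam : -(1 / 2) < lam) (s : Finset ℕ) (f : ℕ → ℝ[X]) (r : ℝ[X]) :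
    ultraInner lam (∑ k ∈ s, f k) r = ∑ k ∈ s, ultraInner lam (f k) r := by
  classical
  induction s using Finset.induction_on with
  | empty => simp [ultraInner]
  | insert a s ha ih => rw [Finset.sum_insert ha, Finset.sum_insert ha, ultraInner_add_left hlam, ih]

lemma ultraInner_X_mul (p q : ℝ[X]) : ultraInner lam (X * p) q = ultraInner lam p (X * q) := by
  simp only [ultraInner, eval_mul, eval_X]
  congr 1
  ext t
  ring

lemma gegen_ode_eval (hlam : -(1 / 2) < lam) (n : ℕ) (t : ℝ) :
    (1 - t ^ 2) * (derivative (derivative (gegen lam n))).eval t -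
      (2 * lam + 1) * t * (derivative (gegen lam n)).eval t =
      -((n : ℝ) * (n + 2 * lam)) * (gegen lam n).eval t := by
  have h := congrArg (eval t) (gegen_ode hlam n)
  simp only [eval_add, eval_sub, eval_mul, eval_pow, eval_C, eval_X, eval_one, eval_zero] at h
  linear_combination h

/-- Eigenfunctions of a symmetric operator with distinct eigenvalues: these differ by `(n - m)(n + m
+ 2λ)`, and the last factor is positive because `n + m ≥ 1` and `2λ > -1`. -/
lemma gegen_orthogonal (hlam : -(1 / 2) < lam) {m n : ℕ} (hmn : m ≠ n) :
    ultraInner lam (gegen lam m) (gegen lam n) = 0 := by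
  have key := integral_ultraspherical_green hlam (c := -1) le_rfl (by norm_num)
    (g := fun t => (gegen lam n).eval t) (g1 := fun t => (derivative (gegen lam n)).eval t)
    (g2 := fun t => (derivative (derivative (gegen lam n))).eval t)
    (h := fun t => (gegen lam m).eval t) (h1 := fun t => (derivative (gegen lam m)).eval t)
    (h2 := fun t => (derivative (derivative (gegen lam m))).eval t)
    (Polynomial.continuousOn _) (Polynomial.continuousOn _) (Polynomial.continuousOn _)
    (Polynomial.continuousOn _)
    (fun t _ => Polynomial.hasDerivAt _ t) (fun t _ => Polynomial.hasDerivAt _ t)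
    (fun t _ => Polynomial.hasDerivAt _ t) (fun t _ => Polynomial.hasDerivAt _ t)
    (by
      have : (1 - (-1 : ℝ) ^ 2) ^ (lam + 1 / 2) = 0 := by
        norm_num
        exact Real.zero_rpow (by linarith)
      rw [this, zero_mul])
    (intervalIntegrable_weight hlam (by fun_prop)) (intervalIntegrable_weight hlam (by fun_prop))
  simp only [gegen_ode_eval hlam] at key
  have e1 : ∀ a b : ℕ, ∫ t in (-1 : ℝ)..1, (gegen lam a).eval t *
      (-((b : ℝ) * (b + 2 * lam)) * (gegen lam b).eval t) * (1 - t ^ 2) ^ (lam - 1 / 2) =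
      -((b : ℝ) * (b + 2 * lam)) * ultraInner lam (gegen lam a) (gegen lam b) := by
    intro a b
    rw [ultraInner, ← integral_const_mul]
    congr 1
    ext t
    ring
  rw [e1, e1, ultraInner_comm (gegen lam n)] at key
  have h2 : ((n : ℝ) - m) * (n + m + 2 * lam) *
      ultraInner lam (gegen lam m) (gegen lam n) = 0 := by linear_combination -key
  rcases mul_eq_zero.1 h2 with h3 | h3
  · rcases mul_eq_zero.1 h3 with h4 | h4
    · exact absurd (by exact_mod_cast (sub_eq_zero.1 h4).symm) hmn
    · exfalso
      have : (1 : ℝ) ≤ n + m := by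
        have : 1 ≤ n + m := by omega
        exact_mod_cast this
      linarith
  · exact h3

/-- The squared norm of the ultraspherical polynomial with value `1` at `1`. -/
noncomputable def gegenNorm (lam : ℝ) (n : ℕ) : ℝ := ultraInner lam (gegen lam n) (gegen lam n)

lemma gegenNorm_one (hlam : -(1 / 2) < lam) :
    2 * (1 + lam) * gegenNorm lam 1 = gegenNorm lam 0 := by
  have hr := congrArg (fun p => ultraInner lam p (gegen lam 0)) (gegen_rec hlam 0)
  simp only [mul_assoc] at hr
  rw [ultraInner_sub_left hlam, ultraInner_C_mul_left, ultraInner_C_mul_left,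
    ultraInner_C_mul_left, gegen_orthogonal hlam (by norm_num), ultraInner_X_mul] at hr
  have e : X * gegen lam 0 = gegen lam 1 := by simp [gegen]
  rw [e] at hr
  simp only [gegenNorm]
  push_cast at hr
  linear_combination -hr

/-- Pair the recurrence for `R_{n+2}` with `R_{n+2}` and the one for `R_{n+3}` with `R_{n+1}`; both
produce the inner product of `X R_{n+1}` and `R_{n+2}`, which is then eliminated. -/
lemma gegenNorm_succ (hlam : -(1 / 2) < lam) (n : ℕ) :
    ((n : ℝ) + 1 + 2 * lam) * ((n : ℝ) + 2 + lam) * gegenNorm lam (n + 2) =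
      ((n : ℝ) + 2) * ((n : ℝ) + 1 + lam) * gegenNorm lam (n + 1) := by
  have hr := congrArg (fun p => ultraInner lam p (gegen lam (n + 2))) (gegen_rec hlam n)
  have hr' := congrArg (fun p => ultraInner lam p (gegen lam (n + 1))) (gegen_rec hlam (n + 1))
  simp only [mul_assoc] at hr hr'
  rw [ultraInner_sub_left hlam, ultraInner_C_mul_left, ultraInner_C_mul_left,
    ultraInner_C_mul_left, gegen_orthogonal hlam (by omega : n ≠ n + 2)] at hr
  rw [ultraInner_sub_left hlam, ultraInner_C_mul_left, ultraInner_C_mul_left,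
    ultraInner_C_mul_left, gegen_orthogonal hlam (by omega : n + 1 + 2 ≠ n + 1), ultraInner_X_mul,
    ultraInner_comm] at hr'
  simp only [gegenNorm]
  push_cast at hr'
  linear_combination ((n : ℝ) + 2 + lam) * hr - ((n : ℝ) + 1 + lam) * hr'

lemma exists_eq_sum_gegen (hlam : -(1 / 2) < lam) (n : ℕ) (p : ℝ[X]) (hp : p.degree < n) :
    ∃ c : ℕ → ℝ, p = ∑ k ∈ Finset.range n, C (c k) * gegen lam k := by
  induction n generalizing p with
  | zero => exact ⟨0, by simpa using hp⟩
  | succ n ih =>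
    obtain ⟨hd, hk⟩ := gegen_degree hlam n
    set b := p.coeff n / (gegen lam n).coeff n with hb
    obtain ⟨c, hc⟩ := ih (p - C b * gegen lam n) (by
      rw [degree_lt_iff_coeff_zero]
      intro m hm
      rw [coeff_sub, coeff_C_mul]
      rcases hm.eq_or_lt with rfl | hm
      · rw [hb, div_mul_cancel₀ _ hk.ne', sub_self]
      · rw [coeff_eq_zero_of_natDegree_lt (lt_of_le_of_lt hd hm),
          (degree_lt_iff_coeff_zero p (n + 1)).1 (by exact_mod_cast hp) m hm]
        simp)
    refine ⟨Function.update c n b, ?_⟩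
    rw [Finset.sum_range_succ, Function.update_self, ← sub_eq_iff_eq_add, hc]
    refine Finset.sum_congr rfl fun k hk => ?_
    rw [Function.update_of_ne (Finset.mem_range.1 hk).ne]

lemma eq_sum_gegen (hlam : -(1 / 2) < lam) (hN : ∀ n, gegenNorm lam n ≠ 0) (n : ℕ) (p : ℝ[X])
    (hp : p.degree < n) :
    p = ∑ k ∈ Finset.range n,
      C (ultraInner lam p (gegen lam k) / gegenNorm lam k) * gegen lam k := by
  obtain ⟨c, hc⟩ := exists_eq_sum_gegen hlam n p hp
  conv_lhs => rw [hc]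
  refine Finset.sum_congr rfl fun k hk => ?_
  congr 2
  rw [hc, ultraInner_sum_left hlam, Finset.sum_eq_single k, ultraInner_C_mul_left]
  · exact (mul_div_cancel_right₀ _ (hN k)).symm
  · intro m _ hm
    rw [ultraInner_C_mul_left, gegen_orthogonal hlam hm, mul_zero]
  · exact fun h => absurd hk h

/-- The difference between `X ^ n` and the monic multiple of `R_n` has degree below `n`. Since `R_n`
is orthogonal to every earlier `R_k`, its expansion coefficients are those of `X ^ n`, which are the
Gram–Schmidt projections. The hypothesis `hN` is later discharged by the closed form of the norms.
-/
lemma ultraMonic_eq (hlam : -(1 / 2) < lam) (hN : ∀ n, gegenNorm lam n ≠ 0) (n : ℕ) :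
    ultraMonic lam n = C (1 / (gegen lam n).coeff n) * gegen lam n := by
  induction n using Nat.strong_induction_on with
  | _ n ih =>
    obtain ⟨hd, hk⟩ := gegen_degree hlam n
    have hexp := eq_sum_gegen hlam hN n (X ^ n - C (1 / (gegen lam n).coeff n) * gegen lam n) (by
      rw [degree_lt_iff_coeff_zero]
      intro m hm
      rw [coeff_sub, coeff_C_mul, coeff_X_pow]
      rcases hm.eq_or_lt with rfl | hm
      · simp [hk.ne']
      · rw [coeff_eq_zero_of_natDegree_lt (lt_of_le_of_lt hd hm), if_neg hm.ne']
        simp)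
    rw [ultraMonic, sub_eq_iff_eq_add, ← sub_eq_iff_eq_add', hexp, Finset.sum_range]
    refine Finset.sum_congr rfl fun k _ => ?_
    have hkk := (gegen_degree hlam (k : ℕ)).2.ne'
    rw [ih k k.isLt, ultraInner_sub_left hlam, ultraInner_C_mul_left (1 / (gegen lam n).coeff n),
      gegen_orthogonal hlam k.isLt.ne', mul_zero, sub_zero, ← mul_assoc, ← C_mul,
      ultraInner_C_mul_left, ultraInner_C_mul_right, ultraInner_C_mul_right]
    congr 2
    have := hN k
    simp only [gegenNorm] at *
    field_simp

lemma ultraOrthonormal_eq (hlam : -(1 / 2) < lam) (hN : ∀ n, gegenNorm lam n ≠ 0) (n : ℕ) :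
    ultraOrthonormal lam n = C (1 / √(gegenNorm lam n)) * gegen lam n := by
  have hk := (gegen_degree hlam n).2
  rw [ultraOrthonormal, ultraMonic_eq hlam hN, ultraInner_C_mul_left, ultraInner_C_mul_right,
    ← mul_assoc, ← C_mul, ← mul_assoc, Real.sqrt_mul (by positivity),
    Real.sqrt_mul_self (by positivity)]
  congr 2
  simp only [gegenNorm]
  field_simp

end Orthogonality

/-! ### Closed form of the moments -/

section Moments

open MeasureTheory Set intervalIntegral

lemma integral_rpow_mul_one_sub_rpow {x y : ℝ} (hx : 0 < x) (hy : 0 < y) :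
    ∫ u in (0 : ℝ)..1, u ^ (x - 1) * (1 - u) ^ (y - 1) =
      Real.Gamma x * Real.Gamma y / Real.Gamma (x + y) := by
  have h := ProbabilityTheory.beta_eq_betaIntegralReal x y hx hy
  rw [ProbabilityTheory.beta] at h
  rw [h, Complex.betaIntegral]
  have e : ∫ u in (0 : ℝ)..1, (u : ℂ) ^ ((x : ℂ) - 1) * (1 - (u : ℂ)) ^ ((y : ℂ) - 1) =
      ∫ u in (0 : ℝ)..1, ((u ^ (x - 1) * (1 - u) ^ (y - 1) : ℝ) : ℂ) := by
    refine integral_congr fun u hu => ?_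
    rw [uIcc_of_le zero_le_one] at hu
    rw [Complex.ofReal_mul, Complex.ofReal_cpow hu.1, Complex.ofReal_cpow (by linarith [hu.2])]
    push_cast
    rfl
  rw [e, intervalIntegral.integral_ofReal, Complex.ofReal_re]

/-- The moments `∫₀¹ t ^ s R_n(t) (1 - t²) ^ (λ - 1/2) dt`. -/
noncomputable def gegenMoment (lam : ℝ) (n : ℕ) (s : ℝ) : ℝ :=
  ∫ t in (0 : ℝ)..1, t ^ s * (gegen lam n).eval t * (1 - t ^ 2) ^ (lam - 1 / 2)

/-- The substitution `u = t ^ 2` turns the integral into a Beta integral. -/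
lemma gegenMoment_zero {lam s : ℝ} (hlam : -(1 / 2) < lam) (hs : -1 < s) :
    gegenMoment lam 0 s = Real.Gamma ((s + 1) / 2) * Real.Gamma (lam + 1 / 2) /
      (2 * Real.Gamma (s / 2 + lam + 1)) := by
  have hsub := integral_comp_mul_deriv''' (a := 0) (b := 1) (f := fun t : ℝ => t ^ 2)
    (f' := fun t => 2 * t)
    (g := fun u : ℝ => u ^ ((s + 1) / 2 - 1) * (1 - u) ^ (lam + 1 / 2 - 1)) (by fun_prop)
    (fun x _ => by simpa using (hasDerivAt_pow 2 x).hasDerivWithinAt)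
    (by
      rintro _ ⟨t, ht, rfl⟩
      simp only [min_eq_left zero_le_one, max_eq_right zero_le_one] at ht
      have h0 := ht.1
      have h1 := ht.2
      refine ContinuousAt.continuousWithinAt (ContinuousAt.mul ?_ ?_)
      · exact ContinuousAt.rpow_const (by fun_prop) (Or.inl (by positivity))
      · exact ContinuousAt.rpow_const (by fun_prop) (Or.inl (by nlinarith)))
    (by
      have := intervalIntegrable_beta (p := 0) (q := 1) (s := (s + 1) / 2 - 1)
        (a := lam + 1 / 2 - 1) one_pos (by linarith) (by linarith)
      rw [intervalIntegrable_iff_integrableOn_Icc_of_le zero_le_one] at this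
      simp only [sub_zero] at this
      refine this.mono_set ?_
      rw [uIcc_of_le zero_le_one]
      rintro _ ⟨t, ht, rfl⟩
      exact ⟨by positivity, pow_le_one₀ ht.1 ht.2⟩)
    (by
      have := (intervalIntegrable_zero_one hlam hs (g := fun _ => 2) (by fun_prop))
      rw [intervalIntegrable_iff_integrableOn_Ioc_of_le zero_le_one] at this
      rw [uIcc_of_le zero_le_one, integrableOn_Icc_iff_integrableOn_Ioc]
      refine this.congr_fun (fun t ht => ?_) measurableSet_Ioc
      have ht0 := ht.1
      have e : t ^ s = (t ^ 2) ^ ((s + 1) / 2 - 1) * t := by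
        rw [← Real.rpow_natCast t 2, ← Real.rpow_mul ht0.le, ← Real.rpow_add_one ht0.ne']
        congr 1
        push_cast
        ring
      simp only [Function.comp]
      rw [e, show lam + 1 / 2 - 1 = lam - 1 / 2 by ring]
      ring)
  norm_num only at hsub
  rw [integral_rpow_mul_one_sub_rpow (by linarith) (by linarith)] at hsub
  rw [show s / 2 + lam + 1 = (s + 1) / 2 + (lam + 1 / 2) by ring, mul_comm (2 : ℝ), ← div_div,
    ← hsub, gegenMoment, eq_div_iff two_ne_zero, ← intervalIntegral.integral_mul_const, integral_of_le zero_le_one,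
    integral_of_le zero_le_one]
  refine setIntegral_congr_fun measurableSet_Ioc fun t ht => ?_
  have ht0 := ht.1
  have e : t ^ s = (t ^ 2) ^ ((s + 1) / 2 - 1) * t := by
    rw [← Real.rpow_natCast t 2, ← Real.rpow_mul ht0.le, ← Real.rpow_add_one ht0.ne']
    congr 1
    push_cast
    ring
  simp only [Function.comp, gegen, eval_one]
  rw [e, show lam + 1 / 2 - 1 = lam - 1 / 2 by ring]
  ring

lemma gegenMoment_integrable {lam s : ℝ} (hlam : -(1 / 2) < lam) (hs : -1 < s) (n : ℕ) :
    IntervalIntegrable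
      (fun t : ℝ => t ^ s * (gegen lam n).eval t * (1 - t ^ 2) ^ (lam - 1 / 2)) volume 0 1 :=
  intervalIntegrable_zero_one hlam hs (Polynomial.continuousOn _)

lemma gegenMoment_one (lam s : ℝ) :
    gegenMoment lam 1 s = gegenMoment lam 0 (s + 1) := by
  rw [gegenMoment, gegenMoment, integral_of_le zero_le_one, integral_of_le zero_le_one]
  refine setIntegral_congr_fun measurableSet_Ioc fun t ht => ?_
  simp only [gegen, eval_one, eval_X]
  rw [Real.rpow_add_one ht.1.ne', mul_one]

lemma gegenMoment_rec {lam s : ℝ} (hlam : -(1 / 2) < lam) (hs : -1 < s) (n : ℕ) :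
    ((n : ℝ) + 1 + 2 * lam) * gegenMoment lam (n + 2) s =
      2 * ((n : ℝ) + 1 + lam) * gegenMoment lam (n + 1) (s + 1) -
        ((n : ℝ) + 1) * gegenMoment lam n s := by
  simp only [gegenMoment]
  rw [← intervalIntegral.integral_const_mul, ← intervalIntegral.integral_const_mul,
    ← intervalIntegral.integral_const_mul, ← intervalIntegral.integral_sub
    ((gegenMoment_integrable hlam (by linarith) _).const_mul _)
    ((gegenMoment_integrable hlam hs _).const_mul _),
    integral_of_le zero_le_one, integral_of_le zero_le_one]
  refine setIntegral_congr_fun measurableSet_Ioc fun t ht => ?_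
  have h := congrArg (eval t) (gegen_rec hlam n)
  simp only [eval_sub, eval_mul, eval_C, eval_X] at h
  rw [Real.rpow_add_one ht.1.ne']
  linear_combination (t ^ s * (1 - t ^ 2) ^ (lam - 1 / 2)) * h

/-- The functional equation of the entire function `1/Γ`. It has no exceptions, since `Real.Gamma`
is `0` at the poles and `0⁻¹ = 0`; moments that vanish at such poles thus need no separate case. -/
lemma inv_Gamma_eq (a : ℝ) : (Real.Gamma a)⁻¹ = a * (Real.Gamma (a + 1))⁻¹ := by
  rcases eq_or_ne a 0 with rfl | ha
  · simp
  · rw [Real.Gamma_add_one ha, mul_inv, mul_inv_cancel_left₀ ha]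

/-- Induction through the three-term recurrence. The exponent `s` stays quantified because
multiplication by `X` shifts it to `s + 1`. -/
lemma gegenMoment_eq {lam : ℝ} (hlam : -(1 / 2) < lam) (n : ℕ) :
    ∀ s : ℝ, -1 < s → gegenMoment lam n s =
      √Real.pi * Real.Gamma (lam + 1 / 2) * Real.Gamma (s + 1) * (2 : ℝ) ^ (-s - 1) *
        (Real.Gamma ((s - n) / 2 + 1))⁻¹ * (Real.Gamma ((s + n) / 2 + lam + 1))⁻¹ := by
  have hbase : ∀ s : ℝ, -1 < s → gegenMoment lam 0 s =
      √Real.pi * Real.Gamma (lam + 1 / 2) * Real.Gamma (s + 1) * (2 : ℝ) ^ (-s - 1) *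
        (Real.Gamma (s / 2 + 1))⁻¹ * (Real.Gamma (s / 2 + lam + 1))⁻¹ := by
    intro s hs
    -- Duplication rewrites the Beta value so that `n` enters only through two reciprocal Gamma
    -- factors, the shape preserved by the recurrence.
    have hdup := Real.Gamma_mul_Gamma_add_half ((s + 1) / 2)
    rw [show (s + 1) / 2 + 1 / 2 = s / 2 + 1 by ring, show 2 * ((s + 1) / 2) = s + 1 by ring,
      show 1 - (s + 1) = -s - 1 + 1 by ring, Real.rpow_add_one two_ne_zero] at hdup
    have hpos : Real.Gamma (s / 2 + 1) ≠ 0 := (Real.Gamma_pos_of_pos (by linarith)).ne'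
    have hpos' : Real.Gamma (s / 2 + lam + 1) ≠ 0 := (Real.Gamma_pos_of_pos (by linarith)).ne'
    rw [gegenMoment_zero hlam hs]
    generalize Real.Gamma (s / 2 + 1) = A at *
    generalize Real.Gamma (s / 2 + lam + 1) = B at *
    generalize Real.Gamma (lam + 1 / 2) = D at *
    generalize Real.Gamma ((s + 1) / 2) = E at *
    field_simp
    linear_combination D * hdup
  induction n using Nat.twoStepInduction with
  | zero => simpa using hbase
  | one =>
    intro s hs
    rw [gegenMoment_one, hbase _ (by linarith)]
    have h1 : Real.Gamma ((s + 1) / 2 + 1) = (s + 1) / 2 * Real.Gamma ((s + 1) / 2) :=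
      Real.Gamma_add_one (by linarith)
    have h2 : (2 : ℝ) ^ (-s - 1) = (2 : ℝ) ^ (-(s + 1) - 1) * 2 := by
      rw [← Real.rpow_add_one two_ne_zero]
      congr 1
      ring
    have hne : s + 1 ≠ 0 := by linarith
    rw [h1, h2, Real.Gamma_add_one hne, Nat.cast_one,
      show (s - 1) / 2 + 1 = (s + 1) / 2 by ring]
    field_simp
  | more n ih1 ih2 =>
    intro s hs
    have hp := gegen_denom_pos hlam n
    refine mul_left_cancel₀ hp.ne' ?_
    rw [gegenMoment_rec hlam hs, ih1 s hs, ih2 (s + 1) (by linarith)]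
    have h2 : (2 : ℝ) ^ (-s - 1) = (2 : ℝ) ^ (-(s + 1) - 1) * 2 := by
      rw [← Real.rpow_add_one two_ne_zero]
      congr 1
      ring
    have hne : s + 1 ≠ 0 := by linarith
    have e1 := inv_Gamma_eq ((s - n) / 2)
    have e2 := inv_Gamma_eq ((s + n) / 2 + lam + 1)
    rw [h2, Real.Gamma_add_one hne]
    push_cast
    rw [show (s + 1 - (n + 1)) / 2 + 1 = (s - n) / 2 + 1 by ring,
      show (s + 1 + (n + 1)) / 2 + lam + 1 = (s + n) / 2 + lam + 1 + 1 by ring,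
      show (s - (n + 2)) / 2 + 1 = (s - n) / 2 by ring,
      show (s + (n + 2)) / 2 + lam + 1 = (s + n) / 2 + lam + 1 + 1 by ring, e1, e2]
    ring

/-- The argument `(s - n)/2 + 1` tends to `-∞`; the reflection formula replaces it by a positive one
and yields the oscillating sine. -/
lemma gegenMoment_eq_sin {lam s : ℝ} (hlam : -(1 / 2) < lam) (hs : -1 < s) {n : ℕ} (hn : s < n) :
    gegenMoment lam n s =
      Real.Gamma (lam + 1 / 2) * Real.Gamma (s + 1) * (2 : ℝ) ^ (-s - 1) / √Real.pi *
        Real.sin (Real.pi * ((n - s) / 2)) *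
        (Real.Gamma ((n : ℝ) / 2 + -s / 2) / Real.Gamma ((n : ℝ) / 2 + (s / 2 + lam + 1))) := by
  have href := Real.Gamma_mul_Gamma_one_sub ((n - s) / 2)
  rw [show 1 - ((n : ℝ) - s) / 2 = (s - n) / 2 + 1 by ring] at href
  have hG : Real.Gamma (((n : ℝ) - s) / 2) ≠ 0 := (Real.Gamma_pos_of_pos (by linarith)).ne'
  have hpi := Real.sq_sqrt Real.pi_pos.le
  have hpi0 : √Real.pi ≠ 0 := (Real.sqrt_pos.2 Real.pi_pos).ne'
  have hinv : (Real.Gamma ((s - n) / 2 + 1))⁻¹ =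
      Real.Gamma ((n - s) / 2) * Real.sin (Real.pi * ((n - s) / 2)) / √Real.pi ^ 2 := by
    rw [eq_div_of_mul_eq hG ((mul_comm _ _).trans href), hpi]
    field_simp
  rw [gegenMoment_eq hlam n s hs, hinv, show (n : ℝ) / 2 + -s / 2 = (n - s) / 2 by ring,
    show (n : ℝ) / 2 + (s / 2 + lam + 1) = (s + n) / 2 + lam + 1 by ring]
  field_simp

end Moments

/-! ### Closed form and positivity of the norms -/

section Norms

open intervalIntegral

lemma gegenNorm_zero {lam : ℝ} (hlam : -(1 / 2) < lam) :
    gegenNorm lam 0 = √Real.pi * Real.Gamma (lam + 1 / 2) / Real.Gamma (lam + 1) := by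
  have h := gegenMoment_zero hlam (s := 0) (by norm_num)
  have hint := intervalIntegrable_weight hlam (g := fun _ => 1) (by fun_prop)
  have e : gegenNorm lam 0 = 2 * gegenMoment lam 0 0 := by
    simp only [gegenNorm, ultraInner, gegenMoment, gegen, eval_one, Real.rpow_zero, mul_one,
      one_mul] at hint ⊢
    rw [← integral_add_adjacent_intervals (b := 0), two_mul]
    · congr 1
      have := integral_comp_neg (a := 0) (b := 1) fun t : ℝ => (1 - t ^ 2) ^ (lam - 1 / 2)
      simpa using this.symm
    · refine hint.mono_set ?_
      rw [Set.uIcc_of_le (by norm_num), Set.uIcc_of_le (by norm_num)]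
      exact Set.Icc_subset_Icc_right (by norm_num)
    · refine hint.mono_set ?_
      rw [Set.uIcc_of_le (by norm_num), Set.uIcc_of_le (by norm_num)]
      exact Set.Icc_subset_Icc_left (by norm_num)
  rw [e, h, zero_add, Real.Gamma_one_half_eq]
  have : Real.Gamma (lam + 1) ≠ 0 := (Real.Gamma_pos_of_pos (by linarith)).ne'
  simp only [zero_div, zero_add]
  field_simp

/-- Stated from degree `1` on: in degree `0` the denominator would contain `λ Γ(2λ)`, which is
degenerate at `λ = 0`. -/
lemma gegenNorm_eq {lam : ℝ} (hlam : -(1 / 2) < lam) (n : ℕ) :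
    gegenNorm lam (n + 1) = gegenNorm lam 0 * (Nat.factorial (n + 1)) * Real.Gamma (2 * lam + 1) /
      (2 * (n + 1 + lam) * Real.Gamma (n + 1 + 2 * lam)) := by
  induction n with
  | zero =>
    rw [← gegenNorm_one hlam]
    have : Real.Gamma (2 * lam + 1) ≠ 0 := (Real.Gamma_pos_of_pos (by linarith)).ne'
    have h1 : 1 + lam ≠ 0 := by linarith
    simp only [Nat.cast_zero, zero_add, Nat.factorial_one, Nat.cast_one]
    rw [add_comm 1 (2 * lam)]
    field_simp
  | succ n ih =>
    have hp := gegen_denom_pos hlam n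
    have hn : (0 : ℝ) ≤ n := n.cast_nonneg
    have hp' : 0 < (n : ℝ) + 1 + lam := by linarith
    have hp2 : 0 < (n : ℝ) + 2 + lam := by linarith
    have hG : Real.Gamma ((n : ℝ) + 1 + 2 * lam) ≠ 0 := (Real.Gamma_pos_of_pos hp).ne'
    have h := gegenNorm_succ hlam n
    rw [ih] at h
    refine mul_left_cancel₀ (mul_pos hp hp2).ne' (h.trans ?_)
    rw [Nat.factorial_succ (n + 1)]
    push_cast
    rw [show (n : ℝ) + 1 + 1 + 2 * lam = n + 1 + 2 * lam + 1 by ring, Real.Gamma_add_one hp.ne',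
      show (n : ℝ) + 1 + 1 + lam = n + 2 + lam by ring]
    field_simp
    ring

lemma gegenNorm_pos {lam : ℝ} (hlam : -(1 / 2) < lam) (n : ℕ) : 0 < gegenNorm lam n := by
  have h0 : 0 < gegenNorm lam 0 := by
    rw [gegenNorm_zero hlam]
    have h1 := Real.Gamma_pos_of_pos (show 0 < lam + 1 / 2 by linarith)
    have h2 := Real.Gamma_pos_of_pos (show 0 < lam + 1 by linarith)
    have := Real.pi_pos
    positivity
  rcases n with _ | n
  · exact h0
  have hn : (0 : ℝ) ≤ n := n.cast_nonneg
  have h1 := Real.Gamma_pos_of_pos (gegen_denom_pos hlam n)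
  have h2 := Real.Gamma_pos_of_pos (show 0 < 2 * lam + 1 by linarith)
  have h3 : 0 < (n : ℝ) + 1 + lam := by linarith
  rw [gegenNorm_eq hlam]
  positivity

end Norms

/-! ### Asymptotics of Gamma ratios -/

section GammaRatio

lemma isBigO_mul_sub_one {α : Type*} {l : Filter α} {f g u : α → ℝ} (hu : Tendsto u l (nhds 0))
    (hf : (fun x => f x - 1) =O[l] u) (hg : (fun x => g x - 1) =O[l] u) :
    (fun x => f x * g x - 1) =O[l] u := by
  have h : (fun x => (f x - 1) * (g x - 1)) =O[l] u := by
    simpa using hf.mul (hg.trans (hu.isBigO_one ℝ))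
  refine ((h.add hf).add hg).congr_left fun x => ?_
  ring

lemma isBigO_inv_sub_one {α : Type*} {l : Filter α} {f u : α → ℝ} (hu : Tendsto u l (nhds 0))
    (hf : (fun x => f x - 1) =O[l] u) : (fun x => (f x)⁻¹ - 1) =O[l] u := by
  have hf1 : Tendsto f l (nhds 1) := by simpa using (hf.trans_tendsto hu).add_const 1
  have h : (fun x => -(f x)⁻¹ * (f x - 1)) =O[l] u := by
    simpa using (((hf1.inv₀ one_ne_zero).neg).isBigO_one ℝ).mul hf
  refine h.congr' ?_ EventuallyEq.rfl
  filter_upwards [hf1.eventually_ne one_ne_zero] with x hx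
  field_simp
  ring

lemma isBigO_sqrt_sub_one {α : Type*} {l : Filter α} {f u : α → ℝ}
    (hf : (fun x => f x - 1) =O[l] u) : (fun x => √(f x) - 1) =O[l] u := by
  refine IsBigO.trans (IsBigO.of_bound 1 (Eventually.of_forall fun x => ?_)) hf
  rw [one_mul, Real.norm_eq_abs, Real.norm_eq_abs]
  rcases le_or_gt 0 (f x) with h | h
  · have e : f x - 1 = (√(f x) - 1) * (√(f x) + 1) := by linear_combination -Real.sq_sqrt h
    rw [e, abs_mul]
    refine le_mul_of_one_le_right (abs_nonneg _) ?_
    rw [abs_of_pos (by positivity)]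
    linarith [Real.sqrt_nonneg (f x)]
  · rw [Real.sqrt_eq_zero_of_nonpos h.le, abs_of_neg (by norm_num), abs_of_neg (by linarith)]
    linarith

/-- Log-convexity of Gamma between `x` and `x + 1`. -/
lemma Gamma_add_le_rpow_mul_Gamma {x a : ℝ} (hx : 0 < x) (ha : 0 < a) (ha1 : a < 1) :
    Real.Gamma (x + a) ≤ x ^ a * Real.Gamma x := by
  have h := Real.Gamma_mul_add_mul_le_rpow_Gamma_mul_rpow_Gamma hx (show 0 < x + 1 by linarith)
    (show 0 < 1 - a by linarith) ha (by ring)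
  have hG := Real.Gamma_pos_of_pos hx
  rw [show (1 - a) * x + a * (x + 1) = x + a by ring, Real.Gamma_add_one hx.ne',
    Real.mul_rpow hx.le hG.le, mul_left_comm, ← Real.rpow_add hG, sub_add_cancel,
    Real.rpow_one] at h
  exact h

/-- The convexity bound at `x` with step `a` bounds the ratio above by `1`; at `x + a` with step `1
- a` it bounds it below by `x / (x + a) ≥ 1 - a / x`. -/
lemma isBigO_Gamma_ratio_of_mem {a : ℝ} (ha : 0 < a) (ha1 : a < 1) :
    (fun x : ℝ => Real.Gamma (x + a) / (x ^ a * Real.Gamma x) - 1) =O[atTop]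
      fun x : ℝ => 1 / x := by
  refine IsBigO.of_bound a ?_
  filter_upwards [eventually_gt_atTop 0] with x hx
  have hG := Real.Gamma_pos_of_pos hx
  have hxa : 0 < x + a := by linarith
  have hGa := Real.Gamma_pos_of_pos hxa
  have hp : 0 < x ^ a * Real.Gamma x := by positivity
  have h1 := Gamma_add_le_rpow_mul_Gamma hx ha ha1
  have h2 := Gamma_add_le_rpow_mul_Gamma hxa (show 0 < 1 - a by linarith) (by linarith)
  rw [show x + a + (1 - a) = x + 1 by ring, Real.Gamma_add_one hx.ne'] at h2
  have h3 : x ^ a * (x + a) ^ (1 - a) ≤ x + a := by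
    calc x ^ a * (x + a) ^ (1 - a) ≤ (x + a) ^ a * (x + a) ^ (1 - a) := by
          gcongr
          linarith
      _ = x + a := by rw [← Real.rpow_add hxa]; simp
  have h4 : x / (x + a) ≤ Real.Gamma (x + a) / (x ^ a * Real.Gamma x) := by
    rw [div_le_div_iff₀ hxa hp]
    calc x * (x ^ a * Real.Gamma x) = x ^ a * (x * Real.Gamma x) := by ring
      _ ≤ x ^ a * ((x + a) ^ (1 - a) * Real.Gamma (x + a)) := by gcongr
      _ = (x ^ a * (x + a) ^ (1 - a)) * Real.Gamma (x + a) := by ring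
      _ ≤ (x + a) * Real.Gamma (x + a) := by gcongr
      _ = Real.Gamma (x + a) * (x + a) := mul_comm _ _
  have h5 : Real.Gamma (x + a) / (x ^ a * Real.Gamma x) ≤ 1 := (div_le_one hp).2 h1
  have h6 : 1 - a / x ≤ x / (x + a) := by
    rw [le_div_iff₀ hxa, sub_mul, div_mul_eq_mul_div, sub_le_iff_le_add, ← sub_le_iff_le_add',
      le_div_iff₀ hx]
    nlinarith
  rw [Real.norm_eq_abs, Real.norm_eq_abs, abs_of_nonpos (by linarith), abs_of_pos (by positivity),
    mul_one_div]
  linarith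

lemma tendsto_one_div_atTop : Tendsto (fun x : ℝ => 1 / x) atTop (nhds 0) := by
  simpa using tendsto_inv_atTop_zero (𝕜 := ℝ)

lemma isBigO_add_div_sub_one (a : ℝ) :
    (fun x : ℝ => (x + a) / x - 1) =O[atTop] fun x : ℝ => 1 / x := by
  refine (isBigO_const_mul_self a _ _).congr' ?_ EventuallyEq.rfl
  filter_upwards [eventually_gt_atTop 0] with x hx
  field_simp
  ring

lemma isBigO_Gamma_ratio_add_one_iff (a : ℝ) :
    ((fun x : ℝ => Real.Gamma (x + (a + 1)) / (x ^ (a + 1) * Real.Gamma x) - 1) =O[atTop]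
      fun x : ℝ => 1 / x) ↔
    ((fun x : ℝ => Real.Gamma (x + a) / (x ^ a * Real.Gamma x) - 1) =O[atTop]
      fun x : ℝ => 1 / x) := by
  have key : ∀ x : ℝ, 0 < x → 0 < x + a →
      Real.Gamma (x + (a + 1)) / (x ^ (a + 1) * Real.Gamma x) =
        Real.Gamma (x + a) / (x ^ a * Real.Gamma x) * ((x + a) / x) := by
    intro x hx hxa
    rw [← add_assoc, Real.Gamma_add_one hxa.ne', Real.rpow_add_one hx.ne']
    field_simp
  constructor
  · intro h
    refine (isBigO_mul_sub_one tendsto_one_div_atTop h (isBigO_inv_sub_one tendsto_one_div_atTop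
      (isBigO_add_div_sub_one a))).congr' ?_ EventuallyEq.rfl
    filter_upwards [eventually_gt_atTop 0, eventually_gt_atTop (-a)] with x hx hxa
    have : 0 < x + a := by linarith
    rw [key x hx this, mul_inv_cancel_right₀ (by positivity)]
  · intro h
    refine (isBigO_mul_sub_one tendsto_one_div_atTop h
      (isBigO_add_div_sub_one a)).congr' ?_ EventuallyEq.rfl
    filter_upwards [eventually_gt_atTop 0, eventually_gt_atTop (-a)] with x hx hxa
    rw [key x hx (by linarith)]

/-- The ratio asymptotics `Γ(x + a) / Γ(x) = x ^ a (1 + O(1 / x))`. -/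
lemma isBigO_Gamma_ratio (a : ℝ) :
    (fun x : ℝ => Real.Gamma (x + a) / (x ^ a * Real.Gamma x) - 1) =O[atTop]
      fun x : ℝ => 1 / x := by
  have hfract : (fun x : ℝ => Real.Gamma (x + Int.fract a) / (x ^ Int.fract a * Real.Gamma x) - 1)
      =O[atTop] fun x : ℝ => 1 / x := by
    rcases (Int.fract_nonneg a).eq_or_lt with h | h
    · rw [← h]
      refine (isBigO_zero _ _).congr' ?_ EventuallyEq.rfl
      filter_upwards [eventually_gt_atTop 0] with x hx
      have := (Real.Gamma_pos_of_pos hx).ne'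
      simp [this]
    · exact isBigO_Gamma_ratio_of_mem h (Int.fract_lt_one a)
  -- The fractional part is settled; the integer part is reached by unit shifts in both directions.
  rw [← Int.fract_add_floor a]
  induction ⌊a⌋ using Int.induction_on with
  | zero => simpa using hfract
  | succ n ih =>
    push_cast
    rw [← add_assoc]
    exact (isBigO_Gamma_ratio_add_one_iff _).2 (by simpa using ih)
  | pred n ih =>
    push_cast at ih ⊢
    refine (isBigO_Gamma_ratio_add_one_iff _).1 ?_
    rw [add_assoc, sub_add_cancel]
    exact ih

end GammaRatio

/-! ### Asymptotics of the normalised moments -/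

section MomentAsymptotics

lemma tendsto_one_div_natCast : Tendsto (fun n : ℕ => 1 / (n : ℝ)) atTop (nhds 0) :=
  tendsto_one_div_atTop.comp tendsto_natCast_atTop_atTop

lemma isBigO_Gamma_ratio_half_nat (a : ℝ) :
    (fun n : ℕ => Real.Gamma ((n : ℝ) / 2 + a) / (((n : ℝ) / 2) ^ a * Real.Gamma ((n : ℝ) / 2)) - 1)
      =O[atTop] fun n : ℕ => 1 / (n : ℝ) := by
  have ht : Tendsto (fun n : ℕ => (n : ℝ) / 2) atTop atTop :=
    tendsto_natCast_atTop_atTop.atTop_div_const two_pos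
  refine ((isBigO_Gamma_ratio a).comp_tendsto ht).trans ?_
  refine (isBigO_const_mul_self 2 _ _).congr_left fun n => ?_
  simp only [Function.comp]
  field_simp

/-- The limiting amplitude of the moments of the orthonormal ultraspherical polynomials. -/
noncomputable def momentAmplitude (lam s : ℝ) : ℝ :=
  √(2 / (gegenNorm lam 0 * Real.Gamma (2 * lam + 1))) *
    (Real.Gamma (lam + 1 / 2) * Real.Gamma (s + 1) * (2 : ℝ) ^ lam / √Real.pi)

/-- An exact factorisation into a constant, the growth `n ^ λ`, and a square root that is `1 +
O(1/n)`. -/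
lemma inv_sqrt_gegenNorm {lam : ℝ} (hlam : -(1 / 2) < lam) {n : ℕ} (hn : 0 < n) :
    (√(gegenNorm lam n))⁻¹ = √(2 / (gegenNorm lam 0 * Real.Gamma (2 * lam + 1))) * (n : ℝ) ^ lam *
      √(((n : ℝ) + lam) / n *
        (Real.Gamma (n + 2 * lam) / ((n : ℝ) ^ (2 * lam) * Real.Gamma n))) := by
  obtain ⟨m, rfl⟩ := Nat.exists_eq_succ_of_ne_zero hn.ne'
  have hn' : (0 : ℝ) < (m.succ : ℝ) := by exact_mod_cast hn
  have h0 := gegenNorm_pos hlam 0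
  have hG := Real.Gamma_pos_of_pos (show 0 < 2 * lam + 1 by linarith)
  have hG1 := Real.Gamma_pos_of_pos hn'
  have hm : (0 : ℝ) ≤ m := m.cast_nonneg
  have hG2 := Real.Gamma_pos_of_pos (show 0 < (m.succ : ℝ) + 2 * lam by push_cast; linarith)
  have hp := Real.rpow_pos_of_pos hn' lam
  have e : (gegenNorm lam m.succ)⁻¹ = 2 / (gegenNorm lam 0 * Real.Gamma (2 * lam + 1)) *
      ((m.succ : ℝ) ^ lam) ^ 2 * (((m.succ : ℝ) + lam) / m.succ *
        (Real.Gamma (m.succ + 2 * lam) / ((m.succ : ℝ) ^ (2 * lam) * Real.Gamma m.succ))) := by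
    have hp2 : (m.succ : ℝ) ^ (2 * lam) = ((m.succ : ℝ) ^ lam) ^ 2 := by
      rw [mul_comm, Real.rpow_mul hn'.le]
      norm_cast
    have hf : ((m + 1).factorial : ℝ) = m.succ * Real.Gamma m.succ := by
      rw [Nat.cast_succ, Real.Gamma_nat_eq_factorial, Nat.factorial_succ]
      push_cast
      ring
    rw [hp2, gegenNorm_eq hlam, hf, show (m : ℝ) + 1 = m.succ by push_cast; ring]
    field_simp
  rw [← Real.sqrt_inv, e, Real.sqrt_mul (by positivity), Real.sqrt_mul (by positivity),
    Real.sqrt_sq hp.le]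

lemma gegenMoment_isBigO {lam s : ℝ} (hlam : -(1 / 2) < lam) (hs : -1 < s) :
    (fun n : ℕ => (√(gegenNorm lam n))⁻¹ * gegenMoment lam n s -
      momentAmplitude lam s * Real.sin (Real.pi * ((n - s) / 2)) * (n : ℝ) ^ (-s - 1))
      =O[atTop] fun n : ℕ => (n : ℝ) ^ (-s - 2) := by
  have h1 := isBigO_Gamma_ratio_half_nat (-s / 2)
  have h2 := isBigO_inv_sub_one tendsto_one_div_natCast
    (isBigO_Gamma_ratio_half_nat (s / 2 + lam + 1))
  have h3 := (isBigO_Gamma_ratio (2 * lam)).comp_tendsto (tendsto_natCast_atTop_atTop (R := ℝ))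
  have h4 := (isBigO_add_div_sub_one lam).comp_tendsto (tendsto_natCast_atTop_atTop (R := ℝ))
  have h5 := isBigO_sqrt_sub_one (isBigO_mul_sub_one tendsto_one_div_natCast h4 h3)
  have h6 := isBigO_mul_sub_one tendsto_one_div_natCast
    (isBigO_mul_sub_one tendsto_one_div_natCast h1 h2) h5
  have hb : (fun n : ℕ => momentAmplitude lam s * Real.sin (Real.pi * ((n - s) / 2)))
      =O[atTop] fun _ : ℕ => (1 : ℝ) := by
    refine IsBigO.of_bound |momentAmplitude lam s| (Eventually.of_forall fun n => ?_)
    rw [Real.norm_eq_abs, abs_mul, norm_one]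
    gcongr
    exact Real.abs_sin_le_one _
  have h7 := (hb.mul (isBigO_refl (fun n : ℕ => (n : ℝ) ^ (-s - 1)) atTop)).mul h6
  refine h7.congr' ?_ ?_
  · filter_upwards [eventually_gt_atTop 0, tendsto_natCast_atTop_atTop.eventually_gt_atTop s]
      with n hn hsn
    have hn' : (0 : ℝ) < n := by exact_mod_cast hn
    rw [inv_sqrt_gegenNorm hlam hn, gegenMoment_eq_sin hlam hs hsn, momentAmplitude]
    generalize √(((n : ℝ) + lam) / n *
        (Real.Gamma (n + 2 * lam) / ((n : ℝ) ^ (2 * lam) * Real.Gamma n))) = E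
    have hG := (Real.Gamma_pos_of_pos (half_pos hn')).ne'
    generalize Real.Gamma ((n : ℝ) / 2) = G at *
    generalize Real.Gamma ((n : ℝ) / 2 + -s / 2) = G1
    generalize Real.Gamma ((n : ℝ) / 2 + (s / 2 + lam + 1)) = G2
    generalize Real.sin (Real.pi * ((n - s) / 2)) = S
    -- Exponent bookkeeping: the two Gamma ratios contribute `(n/2) ^ (-s - λ - 1)`, and with `n ^
    -- λ` from the norm only `n ^ (-s - 1)` and a power of `2` survive.
    have e1 : (n : ℝ) ^ (-s - 1) * (((n : ℝ) / 2) ^ (-s / 2))⁻¹ * ((n : ℝ) / 2) ^ (s / 2 + lam + 1) =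
        (n : ℝ) ^ lam * (2 : ℝ) ^ (-s - 1) * ((2 : ℝ) ^ lam)⁻¹ := by
      rw [← Real.rpow_neg (by positivity), mul_assoc, ← Real.rpow_add (by positivity),
        Real.div_rpow hn'.le two_pos.le, ← Real.rpow_neg two_pos.le, div_eq_mul_inv,
        ← Real.rpow_neg two_pos.le, ← mul_assoc, ← Real.rpow_add hn', mul_assoc,
        ← Real.rpow_add two_pos]
      congr 2 <;> ring
    have e2 : (2 : ℝ) ^ lam ≠ 0 := by positivity
    have e3 : (2 : ℝ) ^ lam * ((2 : ℝ) ^ lam)⁻¹ = 1 := mul_inv_cancel₀ e2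
    have e4 : G⁻¹ * G = 1 := inv_mul_cancel₀ hG
    simp only [div_eq_mul_inv, mul_inv, inv_inv] at *
    generalize √(2 * ((gegenNorm lam 0)⁻¹ * (Real.Gamma (2 * lam + 1))⁻¹)) = Q
    generalize Real.Gamma (lam + 1 * 2⁻¹) = D
    generalize Real.Gamma (s + 1) = D'
    generalize (√Real.pi)⁻¹ = p
    generalize ((n : ℝ) * 2⁻¹) ^ (s * 2⁻¹ + lam + 1) = P2 at *
    generalize (((n : ℝ) * 2⁻¹) ^ (-s * 2⁻¹))⁻¹ = P1 at *
    generalize (n : ℝ) ^ (-s - 1) = Z at *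
    linear_combination (Q * D * D' * p * S * G1 * G2⁻¹ * E) * (2 ^ lam * (Z * P1 * P2) * e4 +
      2 ^ lam * e1 + (n : ℝ) ^ lam * 2 ^ (-s - 1) * e3)
  · filter_upwards [eventually_gt_atTop 0] with n hn
    have hn' : (0 : ℝ) < n := by exact_mod_cast hn
    rw [one_mul, one_div, ← Real.rpow_neg_one, ← Real.rpow_add hn']
    congr 1
    ring

end MomentAsymptotics

/-! ### Expansion for general analytic factors -/

section Functional

open MeasureTheory Set intervalIntegral

variable {lam : ℝ}

/-- The functional `∫₀¹ t ^ s r(t) p̂_n(t) (1 - t²) ^ (λ - 1/2) dt`. -/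
noncomputable def ultraFunctional (lam s : ℝ) (r : ℝ → ℝ) (n : ℕ) : ℝ :=
  (√(gegenNorm lam n))⁻¹ *
    ∫ t in (0 : ℝ)..1, t ^ s * (r t * (gegen lam n).eval t) * (1 - t ^ 2) ^ (lam - 1 / 2)

/-- Cauchy–Schwarz in the pointwise form `|ab| ≤ (a² + b²)/2`: the orthonormal polynomial has mass
at most `1` on `[0, 1]`, and `s > -1/2` makes `t ^ (2s)` integrable. -/
lemma ultraFunctional_bound (hlam : -(1 / 2) < lam) {s : ℝ} (hs : -(1 / 2) < s) {r : ℝ → ℝ}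
    (hr : ContinuousOn r (Icc 0 1)) :
    ∃ C : ℝ, ∀ n, |ultraFunctional lam s r n| ≤ C := by
  refine ⟨((∫ t in (0 : ℝ)..1, t ^ (2 * s) * (r t) ^ 2 * (1 - t ^ 2) ^ (lam - 1 / 2)) + 1) / 2,
    fun n => ?_⟩
  have hN := gegenNorm_pos hlam n
  have i1 := intervalIntegrable_zero_one hlam (s := 2 * s) (by linarith)
    (g := fun t => r t ^ 2) (hr.pow 2)
  have i2 := (ultraInner_integrable hlam (gegen lam n) (gegen lam n))
  have i3 := i2.mono_set (c := 0) (d := 1) (by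
    rw [uIcc_of_le (by norm_num), uIcc_of_le (by norm_num)]
    exact Icc_subset_Icc_left (by norm_num))
  have hle : ∫ t in (0 : ℝ)..1, (gegen lam n).eval t * (gegen lam n).eval t *
      (1 - t ^ 2) ^ (lam - 1 / 2) ≤ gegenNorm lam n := by
    refine integral_mono_interval (by norm_num) (by norm_num) le_rfl ?_ i2
    refine (ae_restrict_iff' measurableSet_Ioc).2 (Eventually.of_forall fun t ht => ?_)
    have : 0 ≤ 1 - t ^ 2 := by nlinarith [ht.1, ht.2]
    exact mul_nonneg (mul_self_nonneg _) (Real.rpow_nonneg this _)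
  rw [ultraFunctional, ← intervalIntegral.integral_const_mul, ← Real.norm_eq_abs]
  refine (intervalIntegral.norm_integral_le_of_norm_le zero_le_one
    (Eventually.of_forall fun t ht => ?_)
    ((i1.add (i3.const_mul (gegenNorm lam n)⁻¹)).div_const 2)).trans ?_
  · have hw : 0 ≤ (1 - t ^ 2) ^ (lam - 1 / 2) :=
      Real.rpow_nonneg (by nlinarith [ht.1, ht.2]) _
    have e1 : t ^ (2 * s) = (t ^ s) ^ 2 := by
      rw [mul_comm, Real.rpow_mul ht.1.le]
      norm_cast
    have e2 : (gegenNorm lam n)⁻¹ = ((√(gegenNorm lam n))⁻¹) ^ 2 := by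
      rw [inv_pow, Real.sq_sqrt hN.le]
    rw [e1, e2, Real.norm_eq_abs, ← mul_assoc, abs_mul, abs_of_nonneg hw]
    generalize (√(gegenNorm lam n))⁻¹ = c
    generalize (gegen lam n).eval t = p
    have h1 : |c * (t ^ s * (r t * p))| ≤ ((t ^ s * r t) ^ 2 + (c * p) ^ 2) / 2 := by
      rw [abs_le]
      constructor <;>
        nlinarith [sq_nonneg (t ^ s * r t - c * p), sq_nonneg (t ^ s * r t + c * p)]
    refine (mul_le_mul_of_nonneg_right h1 hw).trans (le_of_eq ?_)
    ring
  · rw [intervalIntegral.integral_div, intervalIntegral.integral_add i1 (i3.const_mul _),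
      intervalIntegral.integral_const_mul]
    have : (gegenNorm lam n)⁻¹ * ∫ t in (0 : ℝ)..1, (gegen lam n).eval t * (gegen lam n).eval t *
      (1 - t ^ 2) ^ (lam - 1 / 2) ≤ 1 := by
      rw [inv_mul_le_iff₀ hN, mul_one]
      exact hle
    linarith

/-- The first derivative of `t ^ s r(t)` is `t ^ (s - 1)` times this function. -/
noncomputable def rpowDeriv (s : ℝ) (r : ℝ → ℝ) (t : ℝ) : ℝ := s * r t + t * deriv r t

/-- The ultraspherical operator maps `t ^ s r(t)` to `t ^ (s - 2)` times this function. -/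
noncomputable def ultraTransform (lam s : ℝ) (r : ℝ → ℝ) (t : ℝ) : ℝ :=
  (1 - t ^ 2) * rpowDeriv (s - 1) (rpowDeriv s r) t - (2 * lam + 1) * t ^ 2 * rpowDeriv s r t

lemma analyticOnNhd_rpowDeriv (s : ℝ) {r : ℝ → ℝ} {S : Set ℝ} (hr : AnalyticOnNhd ℝ r S) :
    AnalyticOnNhd ℝ (rpowDeriv s r) S := by
  intro t ht
  have h1 := hr t ht
  have h2 := hr.deriv t ht
  unfold rpowDeriv
  fun_prop

lemma analyticOnNhd_ultraTransform (lam s : ℝ) {r : ℝ → ℝ} {S : Set ℝ}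
    (hr : AnalyticOnNhd ℝ r S) : AnalyticOnNhd ℝ (ultraTransform lam s r) S := by
  intro t ht
  have h1 := analyticOnNhd_rpowDeriv s hr t ht
  have h2 := analyticOnNhd_rpowDeriv (s - 1) (analyticOnNhd_rpowDeriv s hr) t ht
  unfold ultraTransform
  fun_prop

lemma hasDerivAt_rpow_mul (s : ℝ) {r : ℝ → ℝ} {t : ℝ} (ht : 0 < t) (hr : DifferentiableAt ℝ r t) :
    HasDerivAt (fun t => t ^ s * r t) (t ^ (s - 1) * rpowDeriv s r t) t := by
  have h := (Real.hasDerivAt_rpow_const (p := s) (Or.inl ht.ne')).mul hr.hasDerivAt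
  refine h.congr_deriv ?_
  have e : t ^ s = t ^ (s - 1) * t := by rw [← Real.rpow_add_one ht.ne', sub_add_cancel]
  rw [rpowDeriv, e]
  ring

/-- Green's identity moves the operator from its eigenfunction to `t ^ s r(t)`. The condition `s >
1` removes the boundary terms at `0` and keeps `t ^ (s - 2)` integrable. -/
lemma ultraFunctional_step (hlam : -(1 / 2) < lam) {s : ℝ} (hs : 1 < s) {r : ℝ → ℝ}
    (hr : AnalyticOnNhd ℝ r (Icc 0 1)) (n : ℕ) :
    (n : ℝ) * (n + 2 * lam) * ultraFunctional lam s r n =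
      -ultraFunctional lam (s - 2) (ultraTransform lam s r) n := by
  have hr1 := analyticOnNhd_rpowDeriv s hr
  have hT := analyticOnNhd_ultraTransform lam s hr
  have e1 : ∀ t : ℝ, t ^ s * r t * ((1 - t ^ 2) * (derivative (derivative (gegen lam n))).eval t -
      (2 * lam + 1) * t * (derivative (gegen lam n)).eval t) * (1 - t ^ 2) ^ (lam - 1 / 2) =
      -((n : ℝ) * (n + 2 * lam)) *
        (t ^ s * (r t * (gegen lam n).eval t) * (1 - t ^ 2) ^ (lam - 1 / 2)) := by
    intro t
    rw [gegen_ode_eval hlam]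
    ring
  have e2 : ∀ t ∈ Ioc (0 : ℝ) 1, (gegen lam n).eval t *
      ((1 - t ^ 2) * (t ^ (s - 1 - 1) * rpowDeriv (s - 1) (rpowDeriv s r) t) -
        (2 * lam + 1) * t * (t ^ (s - 1) * rpowDeriv s r t)) * (1 - t ^ 2) ^ (lam - 1 / 2) =
      t ^ (s - 2) * (ultraTransform lam s r t * (gegen lam n).eval t) *
        (1 - t ^ 2) ^ (lam - 1 / 2) := by
    intro t ht
    have e : t ^ (s - 1) = t ^ (s - 2) * t := by
      rw [← Real.rpow_add_one ht.1.ne']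
      congr 1
      ring
    rw [show s - 1 - 1 = s - 2 by ring, e, ultraTransform]
    ring
  have i1 := intervalIntegrable_zero_one hlam (s := s) (by linarith)
    (hr.continuousOn.mul (Polynomial.continuousOn (gegen lam n)))
  have i2 := intervalIntegrable_zero_one hlam (s := s - 2) (by linarith)
    (hT.continuousOn.mul (Polynomial.continuousOn (gegen lam n)))
  have key := integral_ultraspherical_green hlam (c := 0) (by norm_num) zero_le_one
    (g := fun t => (gegen lam n).eval t) (g1 := fun t => (derivative (gegen lam n)).eval t)
    (g2 := fun t => (derivative (derivative (gegen lam n))).eval t)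
    (h := fun t => t ^ s * r t) (h1 := fun t => t ^ (s - 1) * rpowDeriv s r t)
    (h2 := fun t => t ^ (s - 1 - 1) * rpowDeriv (s - 1) (rpowDeriv s r) t)
    (Polynomial.continuousOn _) (Polynomial.continuousOn _)
    (((Real.continuous_rpow_const (by linarith)).continuousOn).mul hr.continuousOn)
    (((Real.continuous_rpow_const (by linarith)).continuousOn).mul hr1.continuousOn)
    (fun t _ => Polynomial.hasDerivAt _ t) (fun t _ => Polynomial.hasDerivAt _ t)
    (fun t ht => hasDerivAt_rpow_mul s ht.1 (hr t (Ioo_subset_Icc_self ht)).differentiableAt)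
    (fun t ht => hasDerivAt_rpow_mul (s - 1) ht.1
      (hr1 t (Ioo_subset_Icc_self ht)).differentiableAt)
    (by simp [Real.zero_rpow (show s ≠ 0 by linarith), Real.zero_rpow (show s - 1 ≠ 0 by linarith)])
    (by
      simp only [e1]
      exact i1.const_mul _)
    (i2.congr fun t ht => by
      rw [uIoc_of_le zero_le_one] at ht
      exact (e2 t ht).symm)
  simp only [e1] at key
  rw [intervalIntegral.integral_const_mul] at key
  have e3 := integral_congr_ae (μ := volume) (a := 0) (b := 1) (Eventually.of_forall fun t ht =>
    e2 t (by rwa [uIoc_of_le zero_le_one] at ht))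
  rw [e3] at key
  rw [ultraFunctional, ultraFunctional]
  linear_combination -(√(gegenNorm lam n))⁻¹ * key

/-- Each use of `ultraFunctional_step` lowers `s` by `2` and gains `n ^ (-2)`; after `k` uses the
exponent is still above `-1/2`, where the uniform bound applies. -/
lemma ultraFunctional_isBigO_of_large (hlam : -(1 / 2) < lam) (k : ℕ) :
    ∀ (s : ℝ) (r : ℝ → ℝ), 2 * k - 1 / 2 < s → AnalyticOnNhd ℝ r (Icc 0 1) →
      ultraFunctional lam s r =O[atTop] fun n : ℕ => (n : ℝ) ^ (-(2 * k : ℝ)) := by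
  induction k with
  | zero =>
    intro s r hs hr
    obtain ⟨C, hC⟩ := ultraFunctional_bound hlam (s := s) (by push_cast at hs; linarith)
      hr.continuousOn
    refine IsBigO.of_bound C (Eventually.of_forall fun n => ?_)
    simpa using hC n
  | succ k ih =>
    intro s r hs hr
    push_cast at hs
    have hk : (0 : ℝ) ≤ k := k.cast_nonneg
    have h1 := ih (s - 2) (ultraTransform lam s r) (by linarith)
      (analyticOnNhd_ultraTransform lam s hr)
    have h2 := isBigO_inv_sub_one tendsto_one_div_natCast
      ((isBigO_add_div_sub_one (2 * lam)).comp_tendsto (tendsto_natCast_atTop_atTop (R := ℝ)))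
    have h3 : (fun n : ℕ => ((((n : ℝ) + 2 * lam) / n)⁻¹)) =O[atTop] fun _ : ℕ => (1 : ℝ) := by
      have := (h2.trans (tendsto_one_div_natCast.isBigO_one ℝ)).add
        (isBigO_refl (fun _ : ℕ => (1 : ℝ)) atTop)
      simpa using this
    have h4 := ((h1.neg_left.mul h3).mul
      (isBigO_refl (fun n : ℕ => (n : ℝ) ^ (-2 : ℝ)) atTop))
    refine h4.congr' ?_ ?_
    · filter_upwards [eventually_gt_atTop 0,
        tendsto_natCast_atTop_atTop.eventually_gt_atTop (-(2 * lam))] with n hn hl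
      have hn' : (0 : ℝ) < n := by exact_mod_cast hn
      have hl' : 0 < (n : ℝ) + 2 * lam := by linarith
      rw [← ultraFunctional_step hlam (by linarith) hr, Real.rpow_neg hn'.le]
      norm_cast
      push_cast
      field_simp
    · filter_upwards [eventually_gt_atTop 0] with n hn
      have hn' : (0 : ℝ) < n := by exact_mod_cast hn
      rw [mul_one, ← Real.rpow_add hn']
      congr 1
      push_cast
      ring

lemma analyticOnNhd_dslope {r : ℝ → ℝ} {S : Set ℝ} (hr : AnalyticOnNhd ℝ r S) (h0 : 0 ∈ S) :
    AnalyticOnNhd ℝ (dslope r 0) S := by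
  intro t ht
  rcases eq_or_ne t 0 with rfl | hne
  · obtain ⟨p, hp⟩ := hr 0 h0
    exact ⟨_, hp.has_fpower_series_dslope_fslope⟩
  · have h1 := hr t ht
    have h2 : AnalyticAt ℝ (fun x => (x - 0)⁻¹ * (r x - r 0)) t := by
      refine AnalyticAt.mul (AnalyticAt.inv (by fun_prop) (by simpa using hne)) (by fun_prop)
    refine h2.congr ?_
    filter_upwards [eventually_ne_nhds hne] with x hx
    rw [dslope_of_ne _ hx, slope_def_field, div_eq_inv_mul]

lemma ultraFunctional_decomp (hlam : -(1 / 2) < lam) {s : ℝ} (hs : -1 < s) {r : ℝ → ℝ}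
    (hr : AnalyticOnNhd ℝ r (Icc 0 1)) (n : ℕ) :
    ultraFunctional lam s r n = r 0 * ((√(gegenNorm lam n))⁻¹ * gegenMoment lam n s) +
      ultraFunctional lam (s + 1) (dslope r 0) n := by
  have hd := analyticOnNhd_dslope hr (left_mem_Icc.2 zero_le_one)
  have i2 := intervalIntegrable_zero_one hlam (s := s + 1) (by linarith)
    (g := fun t => dslope r 0 t * (gegen lam n).eval t) (hd.continuousOn.mul (Polynomial.continuousOn (gegen lam n)))
  rw [ultraFunctional, ultraFunctional, gegenMoment, mul_left_comm, ← mul_add,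
    ← intervalIntegral.integral_const_mul (r 0), ← intervalIntegral.integral_add
      ((gegenMoment_integrable hlam hs n).const_mul _) i2]
  congr 1
  refine integral_congr_ae (Eventually.of_forall fun t ht => ?_)
  rw [uIoc_of_le zero_le_one] at ht
  have hne := ht.1.ne'
  rw [Real.rpow_add_one hne, dslope_of_ne _ hne, slope_def_field]
  simp only [sub_zero]
  field_simp
  ring

lemma isBigO_natCast_rpow {a b : ℝ} (hab : a ≤ b) :
    (fun n : ℕ => (n : ℝ) ^ a) =O[atTop] fun n : ℕ => (n : ℝ) ^ b := by
  refine IsBigO.of_bound 1 ?_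
  filter_upwards [eventually_ge_atTop 1] with n hn
  have hn' : (1 : ℝ) ≤ n := by exact_mod_cast hn
  rw [one_mul, Real.norm_of_nonneg (by positivity), Real.norm_of_nonneg (by positivity)]
  exact Real.rpow_le_rpow_of_exponent_le hn' hab

lemma gegenMoment_isBigO_rpow (hlam : -(1 / 2) < lam) {s : ℝ} (hs : -1 < s) :
    (fun n : ℕ => (√(gegenNorm lam n))⁻¹ * gegenMoment lam n s)
      =O[atTop] fun n : ℕ => (n : ℝ) ^ (-s - 1) := by
  have hb : (fun n : ℕ => momentAmplitude lam s * Real.sin (Real.pi * ((n - s) / 2)))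
      =O[atTop] fun _ : ℕ => (1 : ℝ) := by
    refine IsBigO.of_bound |momentAmplitude lam s| (Eventually.of_forall fun n => ?_)
    rw [Real.norm_eq_abs, abs_mul, norm_one]
    gcongr
    exact Real.abs_sin_le_one _
  have h1 := hb.mul (isBigO_refl (fun n : ℕ => (n : ℝ) ^ (-s - 1)) atTop)
  simp only [one_mul] at h1
  have h2 := (gegenMoment_isBigO hlam hs).trans
    (isBigO_natCast_rpow (show -s - 2 ≤ -s - 1 by linarith))
  simpa using h2.add h1

/-- Here `m` counts how often the value at `0` is split off before the exponent is large enough for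
`k` integrations by parts. The first moment split off has order `n ^ (-s - 1)`, the final remainder
`n ^ (-2k)`. -/
lemma ultraFunctional_isBigO_min (hlam : -(1 / 2) < lam) (k m : ℕ) :
    ∀ (s : ℝ) (r : ℝ → ℝ), -1 < s → 2 * k - 1 / 2 < s + m → AnalyticOnNhd ℝ r (Icc 0 1) →
      ultraFunctional lam s r =O[atTop] fun n : ℕ => (n : ℝ) ^ (-min (s + 1) (2 * k)) := by
  induction m with
  | zero =>
    intro s r _ hs hr
    exact (ultraFunctional_isBigO_of_large hlam k s r (by simpa using hs) hr).trans
      (isBigO_natCast_rpow (neg_le_neg (min_le_right _ _)))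
  | succ m ih =>
    intro s r hs hsm hr
    have hd := analyticOnNhd_dslope hr (left_mem_Icc.2 zero_le_one)
    have h1 := ih (s + 1) (dslope r 0) (by linarith) (by push_cast at hsm; linarith) hd
    have h2 := h1.trans (isBigO_natCast_rpow
      (neg_le_neg (min_le_min_right (2 * (k : ℝ)) (show s + 1 ≤ s + 1 + 1 by linarith))))
    have h3 := ((gegenMoment_isBigO_rpow hlam hs).trans (isBigO_natCast_rpow (b :=
      -min (s + 1) (2 * k)) (by linarith [min_le_left (s + 1) (2 * (k : ℝ))]))).const_mul_left (r 0)
    exact (h3.add h2).congr_left fun n => (ultraFunctional_decomp hlam hs hr n).symm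

/-- Leading asymptotics of the functional, governed by the value of `r` at `0`. -/
theorem ultraFunctional_asymptotics (hlam : -(1 / 2) < lam) {s : ℝ} (hs : -1 < s) {r : ℝ → ℝ}
    (hr : AnalyticOnNhd ℝ r (Icc 0 1)) :
    (fun n : ℕ => ultraFunctional lam s r n - r 0 * (momentAmplitude lam s *
      Real.sin (Real.pi * ((n - s) / 2)) * (n : ℝ) ^ (-s - 1)))
      =O[atTop] fun n : ℕ => (n : ℝ) ^ (-s - 2) := by
  have hd := analyticOnNhd_dslope hr (left_mem_Icc.2 zero_le_one)
  -- This `k` makes `2k ≥ s + 2`, so the minimum in the remainder bound is `s + 2`, one order beyond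
  -- the leading term.
  obtain ⟨k, hk⟩ := exists_nat_ge (s + 2)
  obtain ⟨m, hm⟩ := exists_nat_gt (2 * (k : ℝ) - 1 / 2 - (s + 1))
  have h1 := ultraFunctional_isBigO_min hlam k m (s + 1) (dslope r 0) (by linarith) (by linarith) hd
  rw [min_eq_left (by linarith)] at h1
  have h2 := ((gegenMoment_isBigO hlam hs).const_mul_left (r 0)).add
    (h1.trans (isBigO_natCast_rpow (show -(s + 1 + 1) ≤ -s - 2 by linarith)))
  refine h2.congr_left fun n => ?_
  rw [ultraFunctional_decomp hlam hs hr n]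
  ring

end Functional

/-! ### Matching the constants with `k_j` -/

section Amplitude

variable {lam : ℝ}

lemma poch_eq_Gamma_div {a : ℝ} (ha : 0 < a) (n : ℕ) :
    poch a n = Real.Gamma (a + n) / Real.Gamma a := by
  have hG := (Real.Gamma_pos_of_pos ha).ne'
  induction n with
  | zero => simp [poch, hG]
  | succ n ih =>
    have hn : (0 : ℝ) ≤ n := n.cast_nonneg
    rw [poch] at ih
    rw [poch, ascPochhammer_succ_eval, ih, Nat.cast_succ, ← add_assoc,
      Real.Gamma_add_one (by linarith)]
    ring

/-- Peeling off the first factor exposes the `λ` that cancels in `k_j`, and leaves symbols with base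
positive even for `λ < 0`. -/
lemma poch_succ_left (a : ℝ) (n : ℕ) : poch a (n + 1) = a * poch (a + 1) n := by
  simp [poch, ascPochhammer_succ_left, eval_comp]

lemma Gamma_duplication (lam : ℝ) :
    Real.Gamma (lam + 1 / 2) * Real.Gamma (lam + 1) =
      Real.Gamma (2 * lam + 1) * (2 : ℝ) ^ (-2 * lam) * √Real.pi := by
  have h := Real.Gamma_mul_Gamma_add_half (lam + 1 / 2)
  rw [show lam + 1 / 2 + 1 / 2 = lam + 1 by ring,
    show 2 * (lam + 1 / 2) = 2 * lam + 1 by ring,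
    show 1 - (2 * lam + 1) = -2 * lam by ring] at h
  exact h

/-- The common factor `2 ^ (-λ)` in the amplitudes. -/
lemma amplitude_prefactor (hlam : -(1 / 2) < lam) :
    Real.Gamma (lam + 1 / 2) ^ 2 * (2 : ℝ) ^ lam =
      (2 : ℝ) ^ (-lam) * (gegenNorm lam 0 * Real.Gamma (2 * lam + 1)) := by
  have hdup := Gamma_duplication lam
  have h1 := (Real.Gamma_pos_of_pos (show 0 < lam + 1 by linarith)).ne'
  have e : (2 : ℝ) ^ (-lam) = (2 : ℝ) ^ lam * (2 : ℝ) ^ (-2 * lam) := by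
    rw [← Real.rpow_add two_pos]
    congr 1
    ring
  rw [gegenNorm_zero hlam, e]
  generalize Real.Gamma (lam + 1 / 2) = A at *
  field_simp
  rw [neg_mul] at hdup
  linear_combination A * hdup

lemma ultraAmplitude_zero (hlam : -(1 / 2) < lam) :
    ultraAmplitude lam 0 = (2 : ℝ) ^ (-lam) * √(2 * Real.Gamma (2 * lam + 1)) := by
  rcases eq_or_ne lam 0 with rfl | hne
  · simp [ultraAmplitude]
  have hG := Real.Gamma_pos_of_pos (show 0 < 2 * lam + 1 by linarith)
  have e : lam * Real.Gamma (2 * lam) = Real.Gamma (2 * lam + 1) / 2 := by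
    rw [Real.Gamma_add_one (by simpa using hne)]
    ring
  have e2 : 2 / Real.Gamma (2 * lam + 1) =
      2 * Real.Gamma (2 * lam + 1) / Real.Gamma (2 * lam + 1) ^ 2 := by
    field_simp
  simp only [ultraAmplitude, if_neg hne, poch, ascPochhammer_zero, eval_one, Nat.factorial_zero,
    Nat.cast_one, Nat.cast_zero, one_mul, mul_zero, zero_add, div_one]
  rw [e, one_div_div, e2, Real.sqrt_div (by positivity), Real.sqrt_sq hG.le, Real.rpow_neg two_pos.le]
  field_simp

/-- A form of `k_j` without singularity at `λ = 0`, built from the same quantities as the norm of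
`R_{n+1}`. -/
lemma ultraAmplitude_succ (hlam : -(1 / 2) < lam) (n : ℕ) :
    ultraAmplitude lam (n + 1) = (2 : ℝ) ^ (-lam) *
      √(4 * (n + 1 + lam) * Real.Gamma (n + 1 + 2 * lam) / (n + 1).factorial) := by
  have hn : (0 : ℝ) ≤ n := n.cast_nonneg
  rcases eq_or_ne lam 0 with rfl | hne
  · have hfac : ((n + 1).factorial : ℝ) = (n + 1) * Real.Gamma (n + 1) := by
      rw [Real.Gamma_nat_eq_factorial, Nat.factorial_succ]
      push_cast
      ring
    have hG := Real.Gamma_pos_of_pos (show 0 < (n : ℝ) + 1 by linarith)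
    rw [hfac]
    simp only [ultraAmplitude, if_true, if_neg n.succ_ne_zero, neg_zero, Real.rpow_zero, one_mul,
      add_zero, mul_zero]
    rw [show 4 * ((n : ℝ) + 1) * Real.Gamma (n + 1) / ((n + 1) * Real.Gamma (n + 1)) = 2 ^ 2 by
      field_simp; norm_num, Real.sqrt_sq two_pos.le]
  have e : lam * Real.Gamma (2 * lam) = Real.Gamma (2 * lam + 1) / 2 := by
    rw [Real.Gamma_add_one (by simpa using hne)]
    ring
  have p1 := poch_eq_Gamma_div (show 0 < 2 * lam + 1 by linarith) n
  have p2 := poch_eq_Gamma_div (show 0 < lam + 1 by linarith) n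
  have p3 := poch_eq_Gamma_div (show 0 < lam + 1 by linarith) (n + 1)
  have p4 := poch_eq_Gamma_div (show 0 < lam + 1 / 2 by linarith) (n + 1)
  have hl : 0 < lam + 1 + n := by linarith
  rw [Nat.cast_succ, ← add_assoc, Real.Gamma_add_one hl.ne'] at p3
  have hdup := Gamma_duplication lam
  have hdup2 := Gamma_duplication (lam + (n + 1))
  rw [show lam + ((n : ℝ) + 1) + 1 / 2 = lam + 1 / 2 + (n + 1) by ring,
    show lam + ((n : ℝ) + 1) + 1 = lam + 1 + n + 1 by ring, Real.Gamma_add_one hl.ne'] at hdup2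
  have hG1 := Real.Gamma_pos_of_pos (show 0 < 2 * lam + 1 by linarith)
  have hG2 := Real.Gamma_pos_of_pos (show 0 < lam + 1 by linarith)
  have hG3 := Real.Gamma_pos_of_pos hl
  have hG4 := Real.Gamma_pos_of_pos (show 0 < lam + 1 / 2 by linarith)
  have hG5 := Real.Gamma_pos_of_pos (show 0 < lam + 1 / 2 + (n + 1) by linarith)
  have hG6 := Real.Gamma_pos_of_pos (show 0 < 2 * lam + 1 + n by linarith)
  have hfac : (0 : ℝ) < (n + 1).factorial := by positivity
  rw [ultraAmplitude, if_neg hne, poch_succ_left, poch_succ_left lam, p1, p2, p3, p4]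
  -- A perfect square is isolated under the root; once extracted, it combines with the factor
  -- outside through duplication at `λ` and at `λ + n + 1`.
  have e3 : 2 * lam * (Real.Gamma (2 * lam + 1 + n) / Real.Gamma (2 * lam + 1)) /
      (((n + 1).factorial : ℝ) * (lam * (Real.Gamma (lam + 1 + n) / Real.Gamma (lam + 1))) *
        ((lam + 1 + n) * Real.Gamma (lam + 1 + n) / Real.Gamma (lam + 1)) * lam *
          Real.Gamma (2 * lam)) =
      4 * (n + 1 + lam) * Real.Gamma (n + 1 + 2 * lam) / (n + 1).factorial *
        (Real.Gamma (lam + 1) / (Real.Gamma (2 * lam + 1) *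
          ((lam + 1 + n) * Real.Gamma (lam + 1 + n)))) ^ 2 := by
    rw [mul_assoc _ lam (Real.Gamma (2 * lam)), e, show (n : ℝ) + 1 + 2 * lam = 2 * lam + 1 + n by ring,
      show (n : ℝ) + 1 + lam = lam + 1 + n by ring]
    generalize Real.Gamma (2 * lam + 1 + n) = A1 at *
    generalize Real.Gamma (2 * lam + 1) = A2 at *
    generalize Real.Gamma (lam + 1 + n) = A3 at *
    generalize Real.Gamma (lam + 1) = A4 at *
    field_simp
    norm_num
  rw [e3, Real.sqrt_mul (by
    have : 0 < (n : ℝ) + 1 + lam := by linarith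
    rw [show (n : ℝ) + 1 + 2 * lam = 2 * lam + 1 + n by ring]
    positivity), Real.sqrt_sq (by positivity)]
  generalize √(4 * ((n : ℝ) + 1 + lam) * Real.Gamma (n + 1 + 2 * lam) / (n + 1).factorial) = S
  push_cast
  rw [show 2 * ((n : ℝ) + 1) + 2 * lam + 1 = 2 * (lam + (n + 1)) + 1 by ring]
  have q1 : (2 : ℝ) ^ (2 * ((n : ℝ) + 1) + lam) * (2 : ℝ) ^ (-lam) *
      (2 : ℝ) ^ (-2 * (lam + ((n : ℝ) + 1))) = (2 : ℝ) ^ (-2 * lam) := by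
    rw [← Real.rpow_add two_pos, ← Real.rpow_add two_pos]
    congr 1
    ring
  have hq1 : (0 : ℝ) < (2 : ℝ) ^ (2 * ((n : ℝ) + 1) + lam) := by positivity
  have hpi : 0 < √Real.pi := Real.sqrt_pos.2 Real.pi_pos
  generalize (2 : ℝ) ^ (2 * ((n : ℝ) + 1) + lam) = T1 at *
  generalize (2 : ℝ) ^ (-2 * (lam + ((n : ℝ) + 1))) = T2 at *
  generalize (2 : ℝ) ^ (-2 * lam) = T3 at *
  generalize (2 : ℝ) ^ (-lam) = T4 at *
  generalize Real.Gamma (2 * lam + 1) = A2 at *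
  generalize Real.Gamma (lam + 1 + n) = A3 at *
  generalize Real.Gamma (lam + 1) = A4 at *
  generalize Real.Gamma (lam + 1 / 2 + (n + 1)) = A5 at *
  generalize Real.Gamma (lam + 1 / 2) = A6 at *
  generalize Real.Gamma (2 * (lam + (n + 1)) + 1) = A7 at *
  field_simp
  refine mul_right_cancel₀ hpi.ne' ?_
  linear_combination S * √Real.pi * A7 * hdup - S * T1 * T4 * A2 * √Real.pi * hdup2 -
    S * √Real.pi ^ 2 * A2 * A7 * q1

/-- At `s = λ - 1/2` the factor `Γ(s + 1)` equals `Γ(λ + 1/2)`, so a square appears and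
`amplitude_prefactor` applies. -/
lemma momentAmplitude_mul (hlam : -(1 / 2) < lam) (j : ℕ) :
    momentAmplitude lam (lam - 1 / 2) * (√(gegenNorm lam j))⁻¹ =
      ultraAmplitude lam j / √Real.pi := by
  have hpre := amplitude_prefactor hlam
  have h0 := gegenNorm_pos hlam 0
  have hG := Real.Gamma_pos_of_pos (show 0 < 2 * lam + 1 by linarith)
  rw [momentAmplitude, show lam - 1 / 2 + 1 = lam + 1 / 2 by ring, ← sq, hpre]
  have key : √(2 / (gegenNorm lam 0 * Real.Gamma (2 * lam + 1))) * (√(gegenNorm lam j))⁻¹ *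
      (gegenNorm lam 0 * Real.Gamma (2 * lam + 1)) * (2 : ℝ) ^ (-lam) = ultraAmplitude lam j := by
    rw [← Real.sqrt_inv, ← Real.sqrt_mul (by positivity)]
    rcases j with _ | j
    · rw [ultraAmplitude_zero hlam, show 2 / (gegenNorm lam 0 * Real.Gamma (2 * lam + 1)) *
        (gegenNorm lam 0)⁻¹ = 2 * Real.Gamma (2 * lam + 1) /
          (gegenNorm lam 0 * Real.Gamma (2 * lam + 1)) ^ 2 by field_simp,
        Real.sqrt_div (by positivity), Real.sqrt_sq (by positivity)]
      field_simp
    · have hj := Real.Gamma_pos_of_pos (gegen_denom_pos hlam j)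
      have hjn : (0 : ℝ) ≤ j := j.cast_nonneg
      have hj2 : 0 < (j : ℝ) + 1 + lam := by linarith
      have hfac : (0 : ℝ) < (j + 1).factorial := by positivity
      rw [ultraAmplitude_succ hlam, gegenNorm_eq hlam]
      have e : 2 / (gegenNorm lam 0 * Real.Gamma (2 * lam + 1)) *
          (gegenNorm lam 0 * (j + 1).factorial * Real.Gamma (2 * lam + 1) /
            (2 * (j + 1 + lam) * Real.Gamma (j + 1 + 2 * lam)))⁻¹ =
          4 * (j + 1 + lam) * Real.Gamma (j + 1 + 2 * lam) / (j + 1).factorial /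
            (gegenNorm lam 0 * Real.Gamma (2 * lam + 1)) ^ 2 := by
        generalize Real.Gamma (j + 1 + 2 * lam) = A at *
        field_simp
        norm_num
      rw [e, Real.sqrt_div (by positivity), Real.sqrt_sq (by positivity)]
      rw [div_mul_cancel₀ _ (by positivity), mul_comm]
  rw [← key]
  ring

end Amplitude

/-! ### Reduction of the coefficient to the functional -/

section Coefficient

open MeasureTheory Set intervalIntegral

variable {lam : ℝ}

/-- The analytic factor `p̂_j(2t - 1) (1 + t) ^ (1/2 - λ)`. -/
noncomputable def coeffFactor (lam : ℝ) (j : ℕ) (t : ℝ) : ℝ :=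
  (ultraOrthonormal lam j).eval (2 * t - 1) * (1 + t) ^ (1 / 2 - lam)

lemma analyticOnNhd_coeffFactor (lam : ℝ) (j : ℕ) :
    AnalyticOnNhd ℝ (coeffFactor lam j) (Icc 0 1) := by
  intro t ht
  refine AnalyticAt.mul ?_ ?_
  · have h : AnalyticAt ℝ (fun t : ℝ => 2 * t - 1) t := by fun_prop
    exact ((AnalyticOnNhd.eval_polynomial (𝕜 := ℝ) (ultraOrthonormal lam j)) _
      (mem_univ _)).comp h
  · have h : ContDiffAt ℝ ⊤ (fun t : ℝ => (1 + t) ^ (1 / 2 - lam)) t :=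
      (contDiffAt_const.add contDiffAt_id).rpow_const_of_ne (by
        have := ht.1
        simp only [id]
        linarith)
    exact h.analyticAt

lemma coeffFactor_zero (hlam : -(1 / 2) < lam) (j : ℕ) :
    coeffFactor lam j 0 = (√(gegenNorm lam j))⁻¹ * (-1) ^ j := by
  rw [coeffFactor, ultraOrthonormal_eq hlam (fun n => (gegenNorm_pos hlam n).ne')]
  simp [gegen_eval_neg_one hlam]

lemma ultraCoeff_eq (hlam : -(1 / 2) < lam) (i j : ℕ) :
    ultraCoeff lam i j = ultraFunctional lam (lam - 1 / 2) (coeffFactor lam j) i := by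
  rw [ultraCoeff, ultraFunctional, ← intervalIntegral.integral_const_mul]
  refine integral_congr_ae (Eventually.of_forall fun t ht => ?_)
  rw [uIoc_of_le zero_le_one] at ht
  have h1 : 0 ≤ 1 - t := by linarith [ht.2]
  have h2 : 0 < 1 + t := by linarith [ht.1]
  rw [ultraOrthonormal_eq hlam (fun n => (gegenNorm_pos hlam n).ne') i, coeffFactor, eval_mul,
    eval_C, one_div, Real.mul_rpow ht.1.le h1, show 1 - t ^ 2 = (1 - t) * (1 + t) by ring,
    Real.mul_rpow h1 h2.le, show 1 / 2 - lam = -(lam - 1 / 2) by ring, Real.rpow_neg h2.le]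
  have h3 := (Real.rpow_pos_of_pos h2 (lam - 1 / 2)).ne'
  field_simp

end Coefficient

theorem mainTheorem4 (lam : ℝ) (hlam : -(1 / 2) < lam) (j : ℕ) :
    (fun i : ℕ => ultraCoeff lam i j -
      ultraAmplitude lam j *
        Real.cos (Real.pi * ((j : ℝ) + lam / 2 - (i : ℝ) / 2 + 1 / 4)) /
          (Real.sqrt Real.pi * (i : ℝ) ^ (lam + 1 / 2)))
      =O[atTop] (fun i : ℕ => 1 / (i : ℝ) ^ (lam + 3 / 2)) := by
  have h := ultraFunctional_asymptotics hlam (s := lam - 1 / 2) (by linarith)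
    (analyticOnNhd_coeffFactor lam j)
  refine h.congr (fun i => ?_) (fun i => ?_)
  · have hamp := momentAmplitude_mul hlam j
    -- The sign `(-1) ^ j` from the value at `-1` becomes the shift by `jπ` in the cosine.
    have hcos : Real.cos (Real.pi * ((j : ℝ) + lam / 2 - (i : ℝ) / 2 + 1 / 4)) =
        (-1) ^ j * Real.sin (Real.pi * (((i : ℝ) - (lam - 1 / 2)) / 2)) := by
      rw [show Real.pi * ((j : ℝ) + lam / 2 - (i : ℝ) / 2 + 1 / 4) =
        Real.pi / 2 - Real.pi * (((i : ℝ) - (lam - 1 / 2)) / 2) + j * Real.pi by ring,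
        Real.cos_add_nat_mul_pi, Real.cos_pi_div_two_sub]
    rw [ultraCoeff_eq hlam, coeffFactor_zero hlam, hcos,
      show -(lam - 1 / 2) - 1 = -(lam + 1 / 2) by ring, Real.rpow_neg i.cast_nonneg]
    simp only [div_eq_mul_inv, mul_inv] at hamp ⊢
    linear_combination -((-1) ^ j * Real.sin (Real.pi * (((i : ℝ) - (lam - 1 * 2⁻¹)) * 2⁻¹)) *
      ((i : ℝ) ^ (lam + 1 * 2⁻¹))⁻¹) * hamp
  · rw [show -(lam - 1 / 2) - 2 = -(lam + 3 / 2) by ring, Real.rpow_neg i.cast_nonneg, one_div]
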